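/- Let $\Sigma$ be a (connected) Riemann surface with complex structure $I$. A \emph{special Kähler structure} on $\Sigma$ is a pair $(g,\nabla)$ of a smooth Riemannian metric $g$ and a smooth connection $\nabla$ on the real tangent bundle $T\Sigma$ such that $(\Sigma,g,I,\omega)$ is Kähler with $\omega(\cdot,\cdot)=g(I\cdot,\cdot)$, the connection $\nabla$ is flat, torsion-free and symplectic ($\nabla\omega=0$), and $(\nabla_XI)Y=(\nabla_YI)X$ for all vector fields $X,Y$. Its \emph{associated cubic form} is $\Xi=-\omega(\pi^{1,0},\nabla\pi^{1,0})$, where $\pi^{1,0}=\tfrac12(1-iI)$ is the projection of $T\Sigma\otimes\mathbb C$ onto its $(1,0)$-part and $\omega$ is extended complex bilinearly; that is, $\Xi(u,v,w)=-\omega\bigl(\pi^{1,0}u,(\nabla_v\pi^{1,0})w\bigr)$. \textbf{Proposition.} (i) Let $(g,\nabla)$ and $(\hat g,\hat\nabla)$ be two special Kähler structures on $\Sigma$ with associated cubic forms $\Xi$ and $\hat\Xi$. If $g=\hat g$, then $\hat\Xi=\lambda\,\Xi$ for some $\lambda\in\mathbb C$ with $|\lambda|=1$. (ii) If $(g,\nabla)$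 is a special Kähler structure on $\Sigma$ with associated cubic form $\Xi$, then for each $\lambda\in S^1$ there is a unique special Kähler structure $(g,\nabla_\lambda)$, with the same metric $g$, whose associated cubic form is $\lambda\,\Xi$. (iii) Consequently, the fibres of the map $(g,\nabla)\mapsto g$ are circles: if $(g,\nabla)$ is a special Kähler structure whose associated cubic form $\Xi$ is not identically zero, then $\lambda\mapsto(g,\nabla_\lambda)$ is a bijection from $S^1$ onto the set of all special Kähler structures with metric $g$, and in fact a homeomorphism when this set carries the topology of pointwise convergence of the connections. -/

import Mathlib

open scoped Manifold ContDiff Bundle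

noncomputable section

namespace SpecialKahler

/-- A Riemann surface is in particular a real analytic manifold (of real dimension two). -/
instance instIsManifoldReal {M : Type*} [TopologicalSpace M] [ChartedSpace ℂ M]
    [h : IsManifold 𝓘(ℂ) ω M] : IsManifold 𝓘(ℝ, ℂ) ω M := by
  refine isManifold_of_contDiffOn _ _ _ fun e e' he he' => ?_
  have h1 := (contDiffGroupoid ω 𝓘(ℂ)).compatible he he'
  rw [contDiffGroupoid, mem_groupoid_of_pregroupoid] at h1
  exact h1.1.restrict_scalars ℝ

/-- Vector fields (real, with no regularity) on a Riemann surface. -/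
abbrev VField (M : Type*) [TopologicalSpace M] [ChartedSpace ℂ M] : Type _ :=
  (x : M) → TangentSpace 𝓘(ℝ, ℂ) x

section Basic

variable {M : Type*} [TopologicalSpace M] [ChartedSpace ℂ M]

/-- The complex structure `I` of a Riemann surface: multiplication by `i` on each tangent space.
(The real tangent space at `x` is identified with `ℂ` through the preferred holomorphic chart
at `x`; changes of charts have complex linear derivatives, so the choice of chart is
immaterial.) -/
def cplx (x : M) : TangentSpace 𝓘(ℝ, ℂ) x →L[ℝ] TangentSpace 𝓘(ℝ, ℂ) x :=
  (Complex.I • ContinuousLinearMap.id ℝ ℂ : ℂ →L[ℝ] ℂ)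

variable [IsManifold 𝓘(ℂ) ω M]

/-- Smooth vector fields. -/
def IsSmoothField (X : VField M) : Prop :=
  ContMDiff 𝓘(ℝ, ℂ) (𝓘(ℝ, ℂ).prod 𝓘(ℝ, ℂ)) ∞
    (fun x => (⟨x, X x⟩ : Bundle.TotalSpace ℂ (fun x : M => TangentSpace 𝓘(ℝ, ℂ) x)))

/-- Vector fields that are differentiable (in the real sense) at the point `x`. -/
def DifferentiableFieldAt (X : VField M) (x : M) : Prop :=
  MDifferentiableAt 𝓘(ℝ, ℂ) (𝓘(ℝ, ℂ).prod 𝓘(ℝ, ℂ))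
    (fun x => (⟨x, X x⟩ : Bundle.TotalSpace ℂ (fun x : M => TangentSpace 𝓘(ℝ, ℂ) x))) x

variable (M) in
/-- Smooth Riemannian metrics. -/
abbrev Metric : Type _ :=
  Bundle.ContMDiffRiemannianMetric 𝓘(ℝ, ℂ) ∞ ℂ (fun x : M => TangentSpace 𝓘(ℝ, ℂ) x)

variable (M) in
/-- Smooth connections on the (real) tangent bundle. The value of a covariant derivative on a vector
field that is not differentiable at the given point carries no information; it is normalized to
be `0`, so that two terms are equal if and only if they are the same connection. -/
@[ext]
structure Connection extends
    CovariantDerivative 𝓘(ℝ, ℂ) ℂ (fun x : M => TangentSpace 𝓘(ℝ, ℂ) x) where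
  smooth : CovariantDerivative.ContMDiffCovariantDerivative toCovariantDerivative ∞
  normalized : ∀ (Y : VField M) (x : M), ¬ DifferentiableFieldAt Y x → toFun Y x = 0

/-- The vector field `∇_X Y`. -/
def Connection.cov (nabla : Connection M) (X Y : VField M) : VField M :=
  fun x => nabla.toFun Y x (X x)

/-- The derivative `X f` of a function `f` along a vector field `X`. -/
def lieDer (X : VField M) (f : M → ℝ) : M → ℝ :=
  fun x => mfderiv 𝓘(ℝ, ℂ) 𝓘(ℝ) f x (X x)

/-- The Lie bracket `[X, Y]` of vector fields. -/
abbrev bracket (X Y : VField M) : VField M :=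
  VectorField.mlieBracket 𝓘(ℝ, ℂ) X Y

/-- The two-form `ω(v, w) = g(I v, w)`. -/
def fundForm (g : Metric M) (x : M) (v w : TangentSpace 𝓘(ℝ, ℂ) x) : ℝ :=
  g.inner x (cplx x v) w

/-- The function `ω(X, Y)` for vector fields `X` and `Y`. -/
def fundFormField (g : Metric M) (X Y : VField M) : M → ℝ :=
  fun x => fundForm g x (X x) (Y x)

/-- `(g, I, ω)` is Kähler: `g` is `I`-invariant and `dω = 0`. (The complex structure `I` is
integrable, since it comes from holomorphic charts.) -/
structure IsKahler (g : Metric M) : Prop where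
  hermitian : ∀ (x : M) (v w : TangentSpace 𝓘(ℝ, ℂ) x),
    g.inner x (cplx x v) (cplx x w) = g.inner x v w
  closed : ∀ X Y Z : VField M, IsSmoothField X → IsSmoothField Y → IsSmoothField Z → ∀ x : M,
    lieDer X (fundFormField g Y Z) x - lieDer Y (fundFormField g X Z) x
      + lieDer Z (fundFormField g X Y) x
      - fundFormField g (bracket X Y) Z x + fundFormField g (bracket X Z) Y x
      - fundFormField g (bracket Y Z) X x = 0

/-- `∇` is flat: `∇_X ∇_Y Z - ∇_Y ∇_X Z - ∇_{[X, Y]} Z = 0`. -/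
def Connection.IsFlat (nabla : Connection M) : Prop :=
  ∀ X Y Z : VField M, IsSmoothField X → IsSmoothField Y → IsSmoothField Z → ∀ x : M,
    nabla.cov X (nabla.cov Y Z) x - nabla.cov Y (nabla.cov X Z) x
      - nabla.cov (bracket X Y) Z x = 0

/-- `∇` is symplectic: `∇ω = 0`. -/
def Connection.IsSymplectic (nabla : Connection M) (g : Metric M) : Prop :=
  ∀ X Y Z : VField M, IsSmoothField X → IsSmoothField Y → IsSmoothField Z → ∀ x : M,
    lieDer X (fundFormField g Y Z) x
      = fundFormField g (nabla.cov X Y) Z x + fundFormField g Y (nabla.cov X Z) x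

/-- `(∇_X I) Y = ∇_X (I Y) - I (∇_X Y)`. -/
def Connection.covCplx (nabla : Connection M) (X Y : VField M) : VField M :=
  fun x => nabla.cov X (fun y => cplx y (Y y)) x - cplx x (nabla.cov X Y x)

/-- The tensor `∇I` on tangent vectors at `x`: `(∇_v I) w`, computed with extensions of `v` and `w`
to vector fields that are smooth near `x`. -/
def Connection.covCplxAt (nabla : Connection M) (x : M) (v w : TangentSpace 𝓘(ℝ, ℂ) x) :
    TangentSpace 𝓘(ℝ, ℂ) x :=
  nabla.covCplx (FiberBundle.extend ℂ v) (FiberBundle.extend ℂ w) x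

end Basic

end SpecialKahler

open SpecialKahler

/-- A special Kähler structure `(g, ∇)` on a Riemann surface with its given complex structure `I`:
`(g, I, ω)` is Kähler and `∇` is a flat symplectic torsion-free connection on the tangent bundle
with `(∇_X I) Y = (∇_Y I) X`. -/
@[ext]
structure SpecialKahlerStructure (M : Type*) [TopologicalSpace M] [ChartedSpace ℂ M]
    [IsManifold 𝓘(ℂ) ω M] where
  metric : Metric M
  conn : Connection M
  kahler : IsKahler metric
  flat : conn.IsFlat
  symplectic : conn.IsSymplectic metric
  torsionFree : conn.toCovariantDerivative.torsion = 0
  special : ∀ X Y : VField M, IsSmoothField X → IsSmoothField Y →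
    conn.covCplx X Y = conn.covCplx Y X

namespace SpecialKahlerStructure

variable {M : Type*} [TopologicalSpace M] [ChartedSpace ℂ M] [IsManifold 𝓘(ℂ) ω M]

/-- The associated cubic form `Ξ = -ω(π, ∇π)`, where `π = (1 - i I) / 2` is the projection of the
complexified tangent bundle onto its `(1, 0)`-part and `ω` is extended complex bilinearly.
Since `∇π = -(i / 2) ∇I`, on real tangent vectors this reads
`Ξ(u, v, w) = -ω(π u, (∇_v π) w) = (i / 2) ω(π u, (∇_v I) w)`
`= (i / 4) (ω(u, (∇_v I) w) - i ω(I u, (∇_v I) w))`.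
In a special holomorphic coordinate `Z` with period map `τ` it is `(1 / 4) (dτ / dZ) dZ ^ 3`. -/
def cubicForm (S : SpecialKahlerStructure M) (x : M) (u v w : TangentSpace 𝓘(ℝ, ℂ) x) : ℂ :=
  (Complex.I / 4) *
    ((fundForm S.metric x u (S.conn.covCplxAt x v w) : ℂ)
      - Complex.I * (fundForm S.metric x (cplx x u) (S.conn.covCplxAt x v w) : ℂ))

/-- The topology of pointwise convergence of `g` and `∇` on the set of special Kähler
structures. -/
instance : TopologicalSpace (SpecialKahlerStructure M) :=
  TopologicalSpace.induced
      (fun S (p : Σ x : M, TangentSpace 𝓘(ℝ, ℂ) x × TangentSpace 𝓘(ℝ, ℂ) x) =>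
        S.metric.inner p.1 p.2.1 p.2.2) inferInstance ⊓
    TopologicalSpace.induced
      (fun S (p : VField M × VField M) => S.conn.cov p.1 p.2) inferInstance

end SpecialKahlerStructure

end

/-! Split `∇ = D + B`, where `D = (∇ - I∇I)/2` commutes with `I` and `B = (∇ + I∇I)/2` anticommutes
with it. The derivative terms cancel in `B`, which is therefore a tensor, complex antilinear in the
differentiated field. The condition `(∇_X I)Y = (∇_Y I)X` makes it symmetric, so `B(v, w) = b
conj(v) conj(w)` in a chart. With `g = h |dz|^2`, the cubic form is `-(i/2) h conj(b) dz^3`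
(`cubicForm_eq`): given `g`, knowing `Ξ` is knowing `B`.

The part `D` is torsion-free and symplectic and commutes with `I`, so it is determined by `g` alone
(`twist_zero_eq`). Hence `(g, Ξ)` determines `∇`.

The curvature of `D + μB` is `R_D + μ d_D B + |μ|^2 [B, B]`, because moving a scalar past `B`
conjugates it (`curvature_twist`). For flat `∇`, the antilinear and linear parts vanish separately:
`d_D B = 0` and `R_D + [B, B] = 0`. So `D + μB` is again flat when `|μ| = 1`, and its cubic form is
`conj(μ) Ξ`; this gives existence in (ii).

For (i), `R_D = -[B, B]` depends only on `g`, which fixes `|b|` and so the pointwise norm of `Ξ`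
(`norm_antiCoef_eq`). The equation `d_D B = 0` makes `Ξ` holomorphic (`analyticAt_cubicForm`). Two
holomorphic cubic forms of equal norm on a connected surface differ by a unit constant, by the
maximum principle and the identity theorem (`exists_unit_mul_eq`). In (iii) the circle map is then a
continuous bijection from a compact space to a Hausdorff space. -/

noncomputable section

open SpecialKahler Bundle Filter Topology

namespace SpecialKahler

/-! ### Complex scalars on the tangent spaces -/

section Scalars

variable {M : Type*} [TopologicalSpace M] [ChartedSpace ℂ M]

instance instModuleComplexTangentSpace (x : M) : Module ℂ (TangentSpace 𝓘(ℝ, ℂ) x) :=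
  inferInstanceAs (Module ℂ ℂ)

lemma cplx_apply (x : M) (v : TangentSpace 𝓘(ℝ, ℂ) x) : cplx x v = Complex.I • v := rfl

lemma ofReal_smul (x : M) (r : ℝ) (v : TangentSpace 𝓘(ℝ, ℂ) x) : (r : ℂ) • v = r • v :=
  Complex.coe_smul (E := ℂ) r v

/-- The coordinate of a tangent vector in the preferred chart at its base point. -/
def toC {x : M} : TangentSpace 𝓘(ℝ, ℂ) x ≃ₗ[ℂ] ℂ := LinearEquiv.refl ℂ ℂ

/-- Multiplication by a complex number on a tangent space of a Riemann surface. -/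
def cmulL (c : ℂ) (x : M) : TangentSpace 𝓘(ℝ, ℂ) x →L[ℝ] TangentSpace 𝓘(ℝ, ℂ) x :=
  (c • ContinuousLinearMap.id ℝ ℂ : ℂ →L[ℝ] ℂ)

@[simp]
lemma cmulL_apply (c : ℂ) (x : M) (v : TangentSpace 𝓘(ℝ, ℂ) x) : cmulL c x v = c • v := rfl

lemma field_smul_smul_comm (f : M → ℝ) (c : ℂ) (Y : VField M) : c • (f • Y) = f • (c • Y) := by
  funext x
  change c • (f x • Y x) = f x • (c • Y x)
  rw [← ofReal_smul, ← ofReal_smul, smul_comm]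

variable [IsManifold 𝓘(ℂ) ω M]

/-- Transition maps are holomorphic, and by uniqueness of derivatives the real derivative is the
restriction of the complex one. This is what makes `I` independent of the chart. -/
lemma tangentCoordChange_smul {x y z : M} (hx : z ∈ (chartAt ℂ x).source)
    (hy : z ∈ (chartAt ℂ y).source) (c v : ℂ) :
    tangentCoordChange 𝓘(ℝ, ℂ) x y z (c * v) = c * tangentCoordChange 𝓘(ℝ, ℂ) x y z v := by
  have h : HasFDerivWithinAt ((extChartAt 𝓘(ℂ) y) ∘ (extChartAt 𝓘(ℂ) x).symm)
      (tangentCoordChange 𝓘(ℂ) x y z) (Set.range 𝓘(ℂ)) (extChartAt 𝓘(ℂ) x z) :=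
    hasFDerivWithinAt_tangentCoordChange (I := 𝓘(ℂ)) (by simp [hx, hy])
  have h' : HasFDerivWithinAt ((extChartAt 𝓘(ℝ, ℂ) y) ∘ (extChartAt 𝓘(ℝ, ℂ) x).symm)
      (tangentCoordChange 𝓘(ℝ, ℂ) x y z) (Set.range 𝓘(ℝ, ℂ)) (extChartAt 𝓘(ℝ, ℂ) x z) :=
    hasFDerivWithinAt_tangentCoordChange (I := 𝓘(ℝ, ℂ)) (by simp [hx, hy])
  have h1 := h.restrictScalars ℝ
  simp only [modelWithCornersSelf_coe, Set.range_id, hasFDerivWithinAt_univ] at h1 h'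
  have h2 := h'.unique h1
  rw [h2]
  simpa using (tangentCoordChange 𝓘(ℂ) x y z).map_smul c v

end Scalars

/-! ### Regularity under multiplication by complex constants -/

section Fields

variable {M : Type*} [TopologicalSpace M] [ChartedSpace ℂ M] [IsManifold 𝓘(ℂ) ω M]

lemma continuousLinearMapAt_smul {x₀ x : M} (hx : x ∈ (chartAt ℂ x₀).source) (c : ℂ)
    (v : TangentSpace 𝓘(ℝ, ℂ) x) :
    (trivializationAt ℂ (TangentSpace 𝓘(ℝ, ℂ)) x₀).continuousLinearMapAt ℝ x (c • v) =
      c * (trivializationAt ℂ (TangentSpace 𝓘(ℝ, ℂ)) x₀).continuousLinearMapAt ℝ x v := by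
  rw [TangentBundle.continuousLinearMapAt_trivializationAt_eq_core hx]
  exact tangentCoordChange_smul (mem_chart_source ℂ x) hx c v

lemma trivializationAt_smul_snd {x₀ x : M} (hx : x ∈ (chartAt ℂ x₀).source) (c : ℂ)
    (v : TangentSpace 𝓘(ℝ, ℂ) x) :
    (trivializationAt ℂ (TangentSpace 𝓘(ℝ, ℂ)) x₀ ⟨x, c • v⟩).2 =
      c * (trivializationAt ℂ (TangentSpace 𝓘(ℝ, ℂ)) x₀ ⟨x, v⟩).2 := by
  have hx' : x ∈ (trivializationAt ℂ (TangentSpace 𝓘(ℝ, ℂ)) x₀).baseSet := by simpa using hx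
  have := continuousLinearMapAt_smul hx c v
  rwa [Trivialization.continuousLinearMapAt_apply,
    Trivialization.coe_linearMapAt_of_mem _ hx'] at this

lemma contMDiffAt_smul {X : VField M} {x : M} {n : WithTop ℕ∞} (c : ℂ)
    (hX : ContMDiffAt 𝓘(ℝ, ℂ) (𝓘(ℝ, ℂ).prod 𝓘(ℝ, ℂ)) n
      (fun y => (⟨y, X y⟩ : TotalSpace ℂ (fun y : M => TangentSpace 𝓘(ℝ, ℂ) y))) x) :
    ContMDiffAt 𝓘(ℝ, ℂ) (𝓘(ℝ, ℂ).prod 𝓘(ℝ, ℂ)) n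
      (fun y => (⟨y, (c • X) y⟩ : TotalSpace ℂ (fun y : M => TangentSpace 𝓘(ℝ, ℂ) y))) x := by
  rw [contMDiffAt_section] at hX ⊢
  have h : ContMDiffAt 𝓘(ℝ, ℂ) 𝓘(ℝ, ℂ) n
      (fun y => c * (trivializationAt ℂ (TangentSpace 𝓘(ℝ, ℂ)) x ⟨y, X y⟩).2) x :=
    (contMDiffAt_const (c := (c • ContinuousLinearMap.id ℝ ℂ : ℂ →L[ℝ] ℂ))).clm_apply hX
  refine h.congr_of_eventuallyEq ?_
  filter_upwards [(chartAt ℂ x).open_source.mem_nhds (mem_chart_source ℂ x)] with y hy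
  exact trivializationAt_smul_snd hy c (X y)

lemma IsSmoothField.smul {X : VField M} (hX : IsSmoothField X) (c : ℂ) : IsSmoothField (c • X) :=
  fun x => contMDiffAt_smul c (hX x)

lemma DifferentiableFieldAt.smul {X : VField M} {x : M} (hX : DifferentiableFieldAt X x) (c : ℂ) :
    DifferentiableFieldAt (c • X) x := by
  rw [DifferentiableFieldAt, mdifferentiableAt_section] at hX ⊢
  have h : MDifferentiableAt 𝓘(ℝ, ℂ) 𝓘(ℝ, ℂ)
      (fun y => c * (trivializationAt ℂ (TangentSpace 𝓘(ℝ, ℂ)) x ⟨y, X y⟩).2) x :=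
    (mdifferentiableAt_const (c := (c • ContinuousLinearMap.id ℝ ℂ : ℂ →L[ℝ] ℂ))).clm_apply hX
  refine h.congr_of_eventuallyEq ?_
  filter_upwards [(chartAt ℂ x).open_source.mem_nhds (mem_chart_source ℂ x)] with y hy
  exact trivializationAt_smul_snd hy c (X y)

lemma IsSmoothField.differentiableAt {X : VField M} (hX : IsSmoothField X) (x : M) :
    DifferentiableFieldAt X x :=
  (hX x).mdifferentiableAt (by simp)

lemma IsSmoothField.add {X Y : VField M} (hX : IsSmoothField X) (hY : IsSmoothField Y) :
    IsSmoothField (X + Y) := ContMDiff.add_section hX hY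

lemma differentiableFieldAt_smul_iff {X : VField M} {x : M} {c : ℂ} (hc : c ≠ 0) :
    DifferentiableFieldAt (c • X) x ↔ DifferentiableFieldAt X x := by
  refine ⟨fun h => ?_, fun h => h.smul c⟩
  have := h.smul c⁻¹
  rwa [smul_smul, inv_mul_cancel₀ hc, one_smul] at this

lemma inCoordinates_cmulL_comp {x₀ x : M} (hx : x ∈ (chartAt ℂ x₀).source) (c : ℂ)
    (φ : TangentSpace 𝓘(ℝ, ℂ) x →L[ℝ] TangentSpace 𝓘(ℝ, ℂ) x) :
    ContinuousLinearMap.inCoordinates ℂ (TangentSpace 𝓘(ℝ, ℂ)) ℂ (TangentSpace 𝓘(ℝ, ℂ))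
      x₀ x x₀ x (cmulL c x ∘L φ) =
    (c • ContinuousLinearMap.id ℝ ℂ : ℂ →L[ℝ] ℂ) ∘L
      ContinuousLinearMap.inCoordinates ℂ (TangentSpace 𝓘(ℝ, ℂ)) ℂ (TangentSpace 𝓘(ℝ, ℂ))
        x₀ x x₀ x φ := by
  ext1
  simp only [ContinuousLinearMap.inCoordinates, ContinuousLinearMap.comp_apply, cmulL_apply]
  rw [continuousLinearMapAt_smul hx]
  rfl

lemma contMDiffAt_cmulL_comp {x : M} {n : WithTop ℕ∞} (c : ℂ)
    {φ : (y : M) → TangentSpace 𝓘(ℝ, ℂ) y →L[ℝ] TangentSpace 𝓘(ℝ, ℂ) y}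
    (hφ : ContMDiffAt 𝓘(ℝ, ℂ) (𝓘(ℝ, ℂ).prod 𝓘(ℝ, ℂ →L[ℝ] ℂ)) n
      (fun y => (⟨y, φ y⟩ : TotalSpace (ℂ →L[ℝ] ℂ)
        (fun y : M => TangentSpace 𝓘(ℝ, ℂ) y →L[ℝ] TangentSpace 𝓘(ℝ, ℂ) y))) x) :
    ContMDiffAt 𝓘(ℝ, ℂ) (𝓘(ℝ, ℂ).prod 𝓘(ℝ, ℂ →L[ℝ] ℂ)) n
      (fun y => (⟨y, cmulL c y ∘L φ y⟩ : TotalSpace (ℂ →L[ℝ] ℂ)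
        (fun y : M => TangentSpace 𝓘(ℝ, ℂ) y →L[ℝ] TangentSpace 𝓘(ℝ, ℂ) y))) x := by
  rw [contMDiffAt_hom_bundle] at hφ ⊢
  refine ⟨hφ.1, ?_⟩
  have h := (contMDiffAt_const (c := (c • ContinuousLinearMap.id ℝ ℂ : ℂ →L[ℝ] ℂ))).clm_comp hφ.2
  refine h.congr_of_eventuallyEq ?_
  filter_upwards [(chartAt ℂ x).open_source.mem_nhds (mem_chart_source ℂ x)] with y hy
  exact inCoordinates_cmulL_comp hy c (φ y)

end Fields
-- The splitting of a connection into parts commuting and anticommuting with `I`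
section Twist

variable {M : Type*} [TopologicalSpace M] [ChartedSpace ℂ M] [IsManifold 𝓘(ℂ) ω M]

namespace Connection

variable (nabla : Connection M)

lemma toFun_add {X Y : VField M} {x : M} (hX : DifferentiableFieldAt X x)
    (hY : DifferentiableFieldAt Y x) :
    nabla.toFun (X + Y) x = nabla.toFun X x + nabla.toFun Y x :=
  nabla.isCovariantDerivativeOnUniv.add hX hY

lemma toFun_leibniz {f : M → ℝ} {Y : VField M} {x : M} (hf : MDifferentiableAt 𝓘(ℝ, ℂ) 𝓘(ℝ) f x)
    (hY : DifferentiableFieldAt Y x) :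
    nabla.toFun (f • Y) x = f x • nabla.toFun Y x + (mvfderiv 𝓘(ℝ, ℂ) f x).smulRight (Y x) :=
  nabla.isCovariantDerivativeOnUniv.leibniz hY hf

lemma toFun_ofReal_smul {Y : VField M} {x : M} (hY : DifferentiableFieldAt Y x) (r : ℝ) :
    nabla.toFun ((r : ℂ) • Y) x = r • nabla.toFun Y x := by
  have : (r : ℂ) • Y = r • Y := by
    funext y
    exact ofReal_smul y r (Y y)
  rw [this]
  exact nabla.isCovariantDerivativeOnUniv.smul_const r hY

lemma toFun_neg {Y : VField M} {x : M} (hY : DifferentiableFieldAt Y x) :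
    nabla.toFun (-Y) x = - nabla.toFun Y x := by
  have := nabla.toFun_ofReal_smul hY (-1)
  simpa using this

lemma toFun_smul {Y : VField M} {x : M} (hY : DifferentiableFieldAt Y x) (c : ℂ)
    (v : TangentSpace 𝓘(ℝ, ℂ) x) :
    nabla.toFun (c • Y) x v =
      (c.re : ℂ) • nabla.toFun Y x v + (c.im : ℂ) • nabla.toFun (Complex.I • Y) x v := by
  have h : c • Y = (c.re : ℂ) • Y + (c.im : ℂ) • (Complex.I • Y) := by
    rw [smul_smul, ← add_smul, Complex.re_add_im]
  rw [h, nabla.toFun_add (hY.smul _) ((hY.smul _).smul _), nabla.toFun_ofReal_smul hY,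
    nabla.toFun_ofReal_smul (hY.smul _), ofReal_smul, ofReal_smul]
  rfl

/-- The covariant derivative `∇ + (μ - 1) B`, where `B` is the part of `∇` that anticommutes
with `I`. -/
def twistFun (mu : ℂ) (Y : VField M) (x : M) :
    TangentSpace 𝓘(ℝ, ℂ) x →L[ℝ] TangentSpace 𝓘(ℝ, ℂ) x :=
  cmulL ((1 + mu) / 2) x ∘L nabla.toFun Y x
    + cmulL ((mu - 1) / 2 * Complex.I) x ∘L nabla.toFun (Complex.I • Y) x

lemma twistFun_apply (mu : ℂ) (Y : VField M) (x : M) (v : TangentSpace 𝓘(ℝ, ℂ) x) :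
    nabla.twistFun mu Y x v = ((1 + mu) / 2) • nabla.toFun Y x v
      + ((mu - 1) / 2 * Complex.I) • nabla.toFun (Complex.I • Y) x v := rfl

/-- The connection `∇ + (μ - 1) B`, where `B` is the part of `∇` that anticommutes with `I`. -/
def twist (mu : ℂ) : Connection M where
  toFun := nabla.twistFun mu
  isCovariantDerivativeOnUniv :=
    { add := by
        intro X Y x hX hY _
        ext v
        change nabla.twistFun mu (X + Y) x v = nabla.twistFun mu X x v + nabla.twistFun mu Y x v
        simp only [twistFun_apply, smul_add, nabla.toFun_add hX hY,
          nabla.toFun_add (DifferentiableFieldAt.smul hX Complex.I)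
            (DifferentiableFieldAt.smul hY Complex.I), _root_.add_apply]
        module
      leibniz := by
        intro Y f x hY hf _
        ext v
        change nabla.twistFun mu (f • Y) x v =
          f x • nabla.twistFun mu Y x v + (mvfderiv 𝓘(ℝ, ℂ) f x v) • Y x
        rw [twistFun_apply, twistFun_apply, field_smul_smul_comm, nabla.toFun_leibniz hf hY,
          nabla.toFun_leibniz hf (DifferentiableFieldAt.smul hY Complex.I)]
        have e1 : (f x • nabla.toFun Y x + (mvfderiv 𝓘(ℝ, ℂ) f x).smulRight (Y x)) v =
            (f x : ℂ) • nabla.toFun Y x v + ((mvfderiv 𝓘(ℝ, ℂ) f x v : ℝ) : ℂ) • Y x := by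
          rw [ofReal_smul, ofReal_smul]; rfl
        have e2 : (f x • nabla.toFun (Complex.I • Y) x
              + (mvfderiv 𝓘(ℝ, ℂ) f x).smulRight ((Complex.I • Y) x)) v =
            (f x : ℂ) • nabla.toFun (Complex.I • Y) x v
              + ((mvfderiv 𝓘(ℝ, ℂ) f x v : ℝ) : ℂ) • (Complex.I • Y x) := by
          rw [ofReal_smul, ofReal_smul]; rfl
        rw [e1, e2, ← ofReal_smul, ← ofReal_smul]
        -- The undifferentiated terms have total coefficient `(1 + μ)/2 + (μ - 1)/2 * I^2 = 1`,
        -- which is the Leibniz rule.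
        have hI := Complex.I_sq
        match_scalars <;> grind }
  smooth := by
    constructor
    constructor
    intro Y hY x hx
    have hY' : IsSmoothField Y := by
      have : ContMDiff _ _ _ _ := contMDiffOn_univ.1 hY
      exact this
    have h1 : ∀ {Z : VField M}, IsSmoothField Z → _ := fun {Z} hZ =>
      (nabla.smooth.contMDiff.contMDiff (σ := Z) (contMDiffOn_univ.2 hZ) x hx).contMDiffAt univ_mem
    refine ContMDiffAt.contMDiffWithinAt ?_
    exact (contMDiffAt_cmulL_comp ((1 + mu) / 2) (h1 hY')).add_section
      (contMDiffAt_cmulL_comp ((mu - 1) / 2 * Complex.I) (h1 (hY'.smul Complex.I)))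
  normalized := by
    intro Y x hY
    have h1 := nabla.normalized Y x hY
    have h2 := nabla.normalized (Complex.I • Y) x
      (by rwa [differentiableFieldAt_smul_iff Complex.I_ne_zero])
    ext v
    simp [twistFun_apply, h1, h2]

lemma twist_apply (mu : ℂ) (Y : VField M) (x : M) (v : TangentSpace 𝓘(ℝ, ℂ) x) :
    (nabla.twist mu).toFun Y x v = ((1 + mu) / 2) • nabla.toFun Y x v
      + ((mu - 1) / 2 * Complex.I) • nabla.toFun (Complex.I • Y) x v := rfl

/-- The part of `∇` that anticommutes with `I`; on special Kähler structures it is `I ∇I / 2`. -/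
def anti (Y : VField M) (x : M) : TangentSpace 𝓘(ℝ, ℂ) x →L[ℝ] TangentSpace 𝓘(ℝ, ℂ) x :=
  cmulL (1 / 2) x ∘L nabla.toFun Y x
    + cmulL (Complex.I / 2) x ∘L nabla.toFun (Complex.I • Y) x

lemma anti_apply (Y : VField M) (x : M) (v : TangentSpace 𝓘(ℝ, ℂ) x) :
    nabla.anti Y x v = (1 / 2 : ℂ) • nabla.toFun Y x v
      + (Complex.I / 2) • nabla.toFun (Complex.I • Y) x v := rfl

/-- The family is affine in `μ`: it starts at the complex linear part `D` for `μ = 0` and passes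
through `∇` at `μ = 1`. -/
lemma twist_eq (mu : ℂ) (Y : VField M) (x : M) (v : TangentSpace 𝓘(ℝ, ℂ) x) :
    (nabla.twist mu).toFun Y x v = (nabla.twist 0).toFun Y x v + mu • nabla.anti Y x v := by
  simp only [twist_apply, anti_apply]
  module

lemma toFun_eq (Y : VField M) (x : M) (v : TangentSpace 𝓘(ℝ, ℂ) x) :
    nabla.toFun Y x v = (nabla.twist 0).toFun Y x v + nabla.anti Y x v := by
  simp only [twist_apply, anti_apply]
  module

lemma toFun_I_smul_I_smul {Y : VField M} {x : M} (hY : DifferentiableFieldAt Y x) :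
    nabla.toFun (Complex.I • (Complex.I • Y)) x = - nabla.toFun Y x := by
  rw [smul_smul, Complex.I_mul_I, neg_one_smul, nabla.toFun_neg hY]

lemma twist_zero_smul {Y : VField M} {x : M} (hY : DifferentiableFieldAt Y x) (c : ℂ)
    (v : TangentSpace 𝓘(ℝ, ℂ) x) :
    (nabla.twist 0).toFun (c • Y) x v = c • (nabla.twist 0).toFun Y x v := by
  rw [toFun_smul _ hY]
  have h : (nabla.twist 0).toFun (Complex.I • Y) x v =
      Complex.I • (nabla.twist 0).toFun Y x v := by
    rw [twist_apply, twist_apply, nabla.toFun_I_smul_I_smul hY, _root_.neg_apply]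
    have hI := Complex.I_sq
    match_scalars <;> grind
  rw [h, smul_smul, ← add_smul, Complex.re_add_im]

lemma anti_add {X Y : VField M} {x : M} (hX : DifferentiableFieldAt X x)
    (hY : DifferentiableFieldAt Y x) (v : TangentSpace 𝓘(ℝ, ℂ) x) :
    nabla.anti (X + Y) x v = nabla.anti X x v + nabla.anti Y x v := by
  have h1 := nabla.toFun_eq (X + Y) x v
  have h2 := nabla.toFun_eq X x v
  have h3 := nabla.toFun_eq Y x v
  rw [toFun_add _ hX hY, toFun_add _ hX hY, _root_.add_apply,
    _root_.add_apply] at h1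
  rw [h2, h3] at h1
  refine (add_left_cancel (a := (nabla.twist 0).toFun X x v + (nabla.twist 0).toFun Y x v) ?_).symm
  rw [← h1]
  abel

lemma anti_smul {Y : VField M} {x : M} (hY : DifferentiableFieldAt Y x) (c : ℂ)
    (v : TangentSpace 𝓘(ℝ, ℂ) x) :
    nabla.anti (c • Y) x v = (starRingEnd ℂ c) • nabla.anti Y x v := by
  rw [anti_apply, smul_comm Complex.I c Y, toFun_smul _ hY,
    toFun_smul _ (hY.smul Complex.I), nabla.toFun_I_smul_I_smul hY, anti_apply,
    _root_.neg_apply]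
  have hc : starRingEnd ℂ c = c.re - c.im * Complex.I := by
    apply Complex.ext <;> simp
  rw [hc]
  have hI := Complex.I_sq
  match_scalars <;> grind

/-- `B` is the difference of the connections `∇` and `D`, so the derivatives of `f` cancel. -/
lemma anti_tensorialAt (x : M) :
    TensorialAt 𝓘(ℝ, ℂ) ℂ (fun Y : VField M => nabla.anti Y x) x where
  smul := by
    intro f Y hf hY
    ext v
    have h1 := nabla.toFun_eq (f • Y) x v
    have h2 := nabla.toFun_eq Y x v
    rw [toFun_leibniz _ hf hY, toFun_leibniz _ hf hY] at h1
    simp only [_root_.add_apply, _root_.smul_apply] at h1 ⊢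
    rw [h2, smul_add] at h1
    have := add_left_cancel (a := f x • (nabla.twist 0).toFun Y x v) (b := f x • nabla.anti Y x v)
      (c := nabla.anti (f • Y) x v)
    refine (this ?_).symm
    apply add_right_cancel (b := (mvfderiv 𝓘(ℝ, ℂ) f x).smulRight (Y x) v)
    rw [h1]
    abel
  add := by
    intro X Y hX hY
    ext v
    exact nabla.anti_add hX hY v

lemma anti_congr {X Y : VField M} {x : M} (hX : DifferentiableFieldAt X x)
    (hY : DifferentiableFieldAt Y x) (h : X x = Y x) : nabla.anti X x = nabla.anti Y x :=
  (nabla.anti_tensorialAt x).pointwise hX hY h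

lemma covCplx_apply (X Y : VField M) (x : M) :
    nabla.covCplx X Y x =
      nabla.toFun (Complex.I • Y) x (X x) - Complex.I • nabla.toFun Y x (X x) := rfl

lemma covCplx_eq_anti (X Y : VField M) (x : M) :
    nabla.covCplx X Y x = (-2 * Complex.I) • nabla.anti Y x (X x) := by
  rw [covCplx_apply, anti_apply]
  have hI := Complex.I_sq
  match_scalars <;> grind

lemma anti_eq_covCplx (X Y : VField M) (x : M) :
    nabla.anti Y x (X x) = (Complex.I / 2) • nabla.covCplx X Y x := by
  rw [covCplx_apply, anti_apply]
  have hI := Complex.I_sq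
  match_scalars <;> grind

lemma covCplx_twist (mu : ℂ) {X Y : VField M} {x : M} (hY : DifferentiableFieldAt Y x) :
    (nabla.twist mu).covCplx X Y x = mu • nabla.covCplx X Y x := by
  rw [covCplx_apply, twist_apply, twist_apply, nabla.toFun_I_smul_I_smul hY, covCplx_apply,
    _root_.neg_apply]
  have hI := Complex.I_sq
  match_scalars <;> grind

lemma IsSmoothField.cov {X Y : VField M} (hX : IsSmoothField X) (hY : IsSmoothField Y) :
    IsSmoothField (nabla.cov X Y) := by
  intro x
  have h1 := (nabla.smooth.contMDiff.contMDiff (σ := Y) (contMDiffOn_univ.2 hY) x trivial).contMDiffAt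
    univ_mem
  exact ContMDiffAt.clm_bundle_apply h1 (hX x)

end Connection

end Twist
-- Coordinate vector fields and their smooth extensions
section Extension

variable {M : Type*} [TopologicalSpace M] [ChartedSpace ℂ M] [IsManifold 𝓘(ℂ) ω M]

/-- A constant vector field on the complex plane. -/
def constField (c : ℂ) : VField ℂ := fun _ => c

lemma contMDiffAt_constField (c z : ℂ) {n : WithTop ℕ∞} :
    ContMDiffAt 𝓘(ℝ, ℂ) (𝓘(ℝ, ℂ).prod 𝓘(ℝ, ℂ)) n
      (fun y => (⟨y, constField c y⟩ : TotalSpace ℂ (fun y : ℂ => TangentSpace 𝓘(ℝ, ℂ) y))) z :=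
  contMDiffAt_vectorSpace_iff_contDiffAt.2 (contDiffAt_const (c := c))

lemma constField_bracket (c d : ℂ) :
    VectorField.mlieBracket 𝓘(ℝ, ℂ) (constField c) (constField d) = 0 := by
  funext z
  rw [← VectorField.mlieBracketWithin_univ, VectorField.mlieBracketWithin_eq_lieBracketWithin]
  have h : ∀ c : ℂ, fderivWithin ℝ (constField c : ℂ → ℂ) Set.univ z = 0 := fun c =>
    fderivWithin_const_apply c
  change fderivWithin ℝ (constField d : ℂ → ℂ) Set.univ z c
    - fderivWithin ℝ (constField c : ℂ → ℂ) Set.univ z d = (0 : ℂ)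
  rw [h, h]
  simp

/-- The coordinate vector field on a chart of a Riemann surface. -/
def coordField (x₀ : M) : VField M :=
  VectorField.mpullback 𝓘(ℝ, ℂ) 𝓘(ℝ, ℂ) (extChartAt 𝓘(ℝ, ℂ) x₀) (constField 1)

lemma mfderiv_extChartAt_smul {x₀ x : M} (hx : x ∈ (chartAt ℂ x₀).source) (c : ℂ)
    (v : TangentSpace 𝓘(ℝ, ℂ) x) :
    mfderiv 𝓘(ℝ, ℂ) 𝓘(ℝ, ℂ) (extChartAt 𝓘(ℝ, ℂ) x₀) x (c • v) =
      c • mfderiv 𝓘(ℝ, ℂ) 𝓘(ℝ, ℂ) (extChartAt 𝓘(ℝ, ℂ) x₀) x v := by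
  have := continuousLinearMapAt_smul hx c v
  rw [TangentBundle.continuousLinearMapAt_trivializationAt hx] at this
  exact this

lemma mfderiv_coordField {x₀ x : M} (hx : x ∈ (chartAt ℂ x₀).source) :
    toC (mfderiv 𝓘(ℝ, ℂ) 𝓘(ℝ, ℂ) (extChartAt 𝓘(ℝ, ℂ) x₀) x (coordField x₀ x)) = 1 :=
  (isInvertible_mfderiv_extChartAt (I := 𝓘(ℝ, ℂ)) (x := x₀) (y := x)
    (by simpa using hx)).self_apply_inverse (constField 1 (extChartAt 𝓘(ℝ, ℂ) x₀ x))

lemma smul_coordField_eq {x₀ x : M} (hx : x ∈ (chartAt ℂ x₀).source) (c : ℂ) :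
    (c • coordField x₀) x = VectorField.mpullback 𝓘(ℝ, ℂ) 𝓘(ℝ, ℂ) (extChartAt 𝓘(ℝ, ℂ) x₀)
      (constField c) x := by
  have hinv := isInvertible_mfderiv_extChartAt (I := 𝓘(ℝ, ℂ)) (x := x₀) (y := x)
    (by simpa using hx)
  apply hinv.injective
  apply toC.injective
  refine ((congrArg toC (mfderiv_extChartAt_smul hx c (coordField x₀ x))).trans ?_).trans
    (congrArg toC (hinv.self_apply_inverse
      (constField c (extChartAt 𝓘(ℝ, ℂ) x₀ x)))).symm
  rw [map_smul, mfderiv_coordField hx]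
  exact mul_one c

lemma toC_coordField_self (x₀ : M) : toC (coordField x₀ x₀) = 1 := by
  have h := mfderiv_coordField (mem_chart_source ℂ x₀)
  rw [mfderiv_extChartAt_self] at h
  exact h

lemma contMDiffAt_coordField {x₀ x : M} (hx : x ∈ (chartAt ℂ x₀).source) :
    ContMDiffAt 𝓘(ℝ, ℂ) (𝓘(ℝ, ℂ).prod 𝓘(ℝ, ℂ)) ∞
      (fun y => (⟨y, coordField x₀ y⟩ : TotalSpace ℂ (fun y : M => TangentSpace 𝓘(ℝ, ℂ) y))) x := by
  have h1 : ContMDiffAt 𝓘(ℝ, ℂ) 𝓘(ℝ, ℂ) ω (extChartAt 𝓘(ℝ, ℂ) x₀) x :=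
    contMDiffAt_extChartAt' hx
  refine ContMDiffAt.mpullback_vectorField_preimage (n := ω) ?_ h1
    (isInvertible_mfderiv_extChartAt (by simpa using hx)) le_top
  exact contMDiffAt_constField 1 _

/-- Brackets are natural under pullback by the chart, and constant fields on the plane commute. -/
lemma coordField_bracket {x₀ x : M} (hx : x ∈ (chartAt ℂ x₀).source) :
    bracket (coordField x₀) (Complex.I • coordField x₀) x = 0 := by
  have h1 : ContMDiffAt 𝓘(ℝ, ℂ) 𝓘(ℝ, ℂ) ω (extChartAt 𝓘(ℝ, ℂ) x₀) x :=
    contMDiffAt_extChartAt' hx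
  have hc : ∀ (c : ℂ) (z : ℂ), DifferentiableFieldAt (constField c) z := fun c z =>
    (contMDiffAt_constField c z (n := 1)).mdifferentiableAt one_ne_zero
  have h2 := VectorField.mpullback_mlieBracket (I := 𝓘(ℝ, ℂ)) (I' := 𝓘(ℝ, ℂ)) (hc 1 _)
    (hc Complex.I (extChartAt 𝓘(ℝ, ℂ) x₀ x)) h1 (by simp)
  rw [constField_bracket] at h2
  have h4 : VectorField.mlieBracket 𝓘(ℝ, ℂ) (coordField x₀) (Complex.I • coordField x₀) x =
      VectorField.mlieBracket 𝓘(ℝ, ℂ) (coordField x₀)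
        (VectorField.mpullback 𝓘(ℝ, ℂ) 𝓘(ℝ, ℂ) (extChartAt 𝓘(ℝ, ℂ) x₀)
          (constField Complex.I)) x := by
    apply Filter.EventuallyEq.mlieBracket_vectorField_eq (EventuallyEq.refl _ _)
    filter_upwards [(chartAt ℂ x₀).open_source.mem_nhds hx] with y hy
    exact smul_coordField_eq hy Complex.I
  refine h4.trans (h2.symm.trans ?_)
  simp

variable [T2Space M]

/-- The axioms of a special Kähler structure quantify over global smooth fields, so the coordinate
field is cut off by a bump function; its germ at the centre is unchanged. -/
lemma exists_smoothField (x₀ : M) :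
    ∃ X : VField M, IsSmoothField X ∧ X =ᶠ[𝓝 x₀] coordField x₀ := by
  let f : SmoothBumpFunction 𝓘(ℝ, ℂ) x₀ := Classical.choice inferInstance
  refine ⟨(f : M → ℝ) • coordField x₀, ?_, ?_⟩
  · exact ContMDiffOn.smul_section_of_tsupport f.contMDiff.contMDiffOn (chartAt ℂ x₀).open_source
      f.tsupport_subset_chartAt_source
      (fun x hx => (contMDiffAt_coordField hx).contMDiffWithinAt)
  · filter_upwards [f.eventuallyEq_one] with y hy
    change f y • coordField x₀ y = _
    rw [hy]
    exact one_smul ℝ _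

lemma exists_smoothField_one (x₀ : M) :
    ∃ X : VField M, IsSmoothField X ∧ toC (X x₀) = 1 := by
  obtain ⟨X, hX, h⟩ := exists_smoothField x₀
  exact ⟨X, hX, by rw [h.self_of_nhds, toC_coordField_self]⟩

end Extension
-- Hermitian metrics at a point
section UnitVector

variable {M : Type*} [TopologicalSpace M] [ChartedSpace ℂ M]

/-- The tangent vector with coordinate `1` in the preferred chart. -/
def unitVec (x : M) : TangentSpace 𝓘(ℝ, ℂ) x := toC.symm 1

lemma eq_toC_smul_unitVec {x : M} (v : TangentSpace 𝓘(ℝ, ℂ) x) : v = toC v • unitVec x := by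
  apply toC.injective
  simp [unitVec]

end UnitVector

section Metric

variable {M : Type*} [TopologicalSpace M] [ChartedSpace ℂ M] [IsManifold 𝓘(ℂ) ω M]

/-- The coefficient `h` of a hermitian metric `h |dz|^2` in the preferred chart at `x`. -/
def metricCoef (g : Metric M) (x : M) : ℝ := g.inner x (unitVec x) (unitVec x)

lemma metricCoef_pos (g : Metric M) (x : M) : 0 < metricCoef g x :=
  g.pos x _ (by simp [unitVec])

/-- Invariance under `I` makes `1` and `i` orthogonal and of equal length, so one positive number
describes `g` at `x`. -/
lemma IsKahler.inner_eq {g : Metric M} (hg : IsKahler g) (x : M) (v w : TangentSpace 𝓘(ℝ, ℂ) x) :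
    g.inner x v w = metricCoef g x * (toC v * starRingEnd ℂ (toC w)).re := by
  have key : ∀ u : TangentSpace 𝓘(ℝ, ℂ) x,
      u = (toC u).re • unitVec x + (toC u).im • cplx x (unitVec x) := by
    intro u
    rw [cplx_apply, ← ofReal_smul, ← ofReal_smul, smul_smul, ← add_smul, Complex.re_add_im]
    exact eq_toC_smul_unitVec u
  have h1 := hg.hermitian x (unitVec x) (unitVec x)
  have h2 := hg.hermitian x (unitVec x) (cplx x (unitVec x))
  have h3 : cplx x (cplx x (unitVec x)) = - unitVec x := by
    rw [cplx_apply, cplx_apply, smul_smul, Complex.I_mul_I, neg_one_smul]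
  rw [h3, map_neg, g.symm] at h2
  have h4 : g.inner x (unitVec x) (cplx x (unitVec x)) = 0 := by linarith
  have h5 := g.symm x (cplx x (unitVec x)) (unitVec x)
  rw [h4] at h5
  conv_lhs => rw [key v, key w]
  simp only [map_add, map_smul, _root_.add_apply, _root_.smul_apply, h1, h4, h5, smul_eq_mul,
    Complex.mul_re, Complex.conj_re, Complex.conj_im, metricCoef]
  ring

lemma IsKahler.fundForm_eq {g : Metric M} (hg : IsKahler g) (x : M)
    (v w : TangentSpace 𝓘(ℝ, ℂ) x) :
    fundForm g x v w =
      metricCoef g x * ((toC v).re * (toC w).im - (toC v).im * (toC w).re) := by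
  rw [fundForm, hg.inner_eq, cplx_apply, map_smul]
  simp only [smul_eq_mul, Complex.mul_re, Complex.mul_im, Complex.conj_re, Complex.conj_im,
    Complex.I_re, Complex.I_im]
  ring

end Metric

end SpecialKahler

/-! ### The anticommuting part of a special Kähler structure and its cubic form -/

namespace SpecialKahlerStructure

variable {M : Type*} [TopologicalSpace M] [ChartedSpace ℂ M] [IsManifold 𝓘(ℂ) ω M]
variable (S : SpecialKahlerStructure M)

/-- Since `ω` is `I`-invariant, conjugating `∇` by `I` preserves `∇ω = 0`. So `D` is symplectic and
`B` is `ω`-skew; as `B` anticommutes with `I`, `iB` is skew too. No condition on `|μ|` is needed. -/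
lemma symplectic_twist (mu : ℂ) : (S.conn.twist mu).IsSymplectic S.metric := by
  intro X Y Z hX hY hZ x
  have E1 := S.symplectic X Y Z hX hY hZ x
  have E2 := S.symplectic X (Complex.I • Y) (Complex.I • Z) hX (hY.smul _) (hZ.smul _) x
  have E3 := S.symplectic X (Complex.I • Y) Z hX (hY.smul _) hZ x
  have E4 := S.symplectic X (Complex.I • (Complex.I • Y)) (Complex.I • Z) hX
    ((hY.smul _).smul _) (hZ.smul _) x
  have hinv : ∀ Y Z : VField M, fundFormField S.metric (Complex.I • Y) (Complex.I • Z)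
      = fundFormField S.metric Y Z := by
    intro Y Z
    funext y
    simp only [fundFormField, S.kahler.fundForm_eq, Pi.smul_apply, map_smul, smul_eq_mul,
      Complex.mul_re, Complex.mul_im, Complex.I_re, Complex.I_im]
    ring
  -- `I`-invariance equates the left sides of `E1` and `E2`, and those of `E3` and `E4`, so all
  -- derivatives of functions can be eliminated.
  rw [hinv] at E2 E4
  rw [E1] at E2 ⊢
  rw [E3] at E4
  simp only [fundFormField, Connection.cov, S.kahler.fundForm_eq, Connection.twist_apply,
    S.conn.toFun_I_smul_I_smul (hY.differentiableAt x), _root_.neg_apply, map_neg, map_add,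
    Pi.smul_apply, map_smul, smul_eq_mul,
    Complex.mul_re, Complex.mul_im, Complex.I_re, Complex.I_im, Complex.add_re, Complex.add_im,
    Complex.neg_re, Complex.neg_im] at E2 E4 ⊢
  have e1 : ((1 + mu) / 2).re = (1 + mu.re) / 2 := by simp
  have e2 : ((1 + mu) / 2).im = mu.im / 2 := by simp
  have e3 : ((mu - 1) / 2).re = (mu.re - 1) / 2 := by simp
  have e4 : ((mu - 1) / 2).im = mu.im / 2 := by simp
  rw [e1, e2, e3, e4]
  linear_combination (1 - mu.re) / 2 * E2 + mu.im / 2 * E4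

variable {S}

lemma anti_symm_of_smooth {X Y : VField M} (hX : IsSmoothField X) (hY : IsSmoothField Y) (x : M) :
    S.conn.anti Y x (X x) = S.conn.anti X x (Y x) := by
  rw [S.conn.anti_eq_covCplx, S.conn.anti_eq_covCplx, S.special X Y hX hY]

variable (S) in
/-- The coefficient `b` of the part `v, w ↦ b conj v conj w` of the connection anticommuting with
the complex structure, in the preferred chart at `x`. -/
def antiCoef (x : M) : ℂ :=
  toC (S.conn.anti (FiberBundle.extend ℂ (unitVec x)) x (unitVec x))

variable [T2Space M]

/-- Tensoriality reduces to complex multiples of one field `E`. Antilinearity in the field is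
`anti_smul`; symmetry transfers it to the direction. -/
lemma toC_anti {Y : VField M} {x : M} (hY : DifferentiableFieldAt Y x)
    (v : TangentSpace 𝓘(ℝ, ℂ) x) :
    toC (S.conn.anti Y x v) =
      S.antiCoef x * starRingEnd ℂ (toC v) * starRingEnd ℂ (toC (Y x)) := by
  obtain ⟨E, hE, hE1⟩ := exists_smoothField_one x
  have hEu : E x = unitVec x := by
    apply toC.injective
    rw [hE1]
    simp [unitVec]
  have h0 : S.conn.anti (FiberBundle.extend ℂ (unitVec x)) x = S.conn.anti E x :=
    S.conn.anti_congr (FiberBundle.mdifferentiableAt_extend ..) (hE.differentiableAt x) (by simp [hEu])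
  have h1 : S.conn.anti Y x = S.conn.anti (toC (Y x) • E) x :=
    S.conn.anti_congr hY ((hE.differentiableAt x).smul _) (by
      rw [Pi.smul_apply, hEu]; exact eq_toC_smul_unitVec _)
  have h2 : v = (toC v • E) x := by
    rw [Pi.smul_apply, hEu]; exact eq_toC_smul_unitVec _
  rw [h1, S.conn.anti_smul (hE.differentiableAt x), antiCoef, h0]
  conv_lhs => rw [h2]
  rw [anti_symm_of_smooth (hE.smul _) hE, S.conn.anti_smul (hE.differentiableAt x), hEu]
  simp only [map_smul, smul_eq_mul]
  ring

lemma anti_symm {X Y : VField M} {x : M} (hX : DifferentiableFieldAt X x)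
    (hY : DifferentiableFieldAt Y x) : S.conn.anti Y x (X x) = S.conn.anti X x (Y x) := by
  apply toC.injective
  rw [toC_anti hX, toC_anti hY]
  ring

variable (S) in
-- Adding a symmetric tensor to a connection leaves its torsion unchanged.
lemma torsion_twist (mu : ℂ) : (S.conn.twist mu).toCovariantDerivative.torsion = 0 := by
  rw [CovariantDerivative.torsion_eq_zero_iff]
  intro X Y x hX hY
  have h := (CovariantDerivative.torsion_eq_zero_iff S.conn.toCovariantDerivative).1
    S.torsionFree hX hY
  rw [← h, (S.conn.twist_eq mu), (S.conn.twist_eq mu), S.conn.toFun_eq Y, S.conn.toFun_eq X,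
    anti_symm hX hY]
  abel

/-- Here `∇I = -2iB`, and pairing with the `(1,0)`-part of `u` is conjugate linear in the other
argument. This turns `b conj(v) conj(w)` into `conj(b) v w`. -/
lemma cubicForm_eq (x : M) (u v w : TangentSpace 𝓘(ℝ, ℂ) x) :
    S.cubicForm x u v w = -(Complex.I / 2) * metricCoef S.metric x *
      starRingEnd ℂ (S.antiCoef x) * toC u * toC v * toC w := by
  have h : S.conn.covCplxAt x v w =
      (-2 * Complex.I) • S.conn.anti (FiberBundle.extend ℂ w) x v := by
    rw [Connection.covCplxAt, Connection.covCplx_eq_anti, FiberBundle.extend_apply_self]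
  have h' : toC (S.conn.covCplxAt x v w) = -2 * Complex.I *
      (S.antiCoef x * starRingEnd ℂ (toC v) * starRingEnd ℂ (toC w)) := by
    rw [h, map_smul, toC_anti (FiberBundle.mdifferentiableAt_extend ..), FiberBundle.extend_apply_self,
      smul_eq_mul]
  have hH : ∀ a : TangentSpace 𝓘(ℝ, ℂ) x,
      (fundForm S.metric x u a : ℂ) - Complex.I * (fundForm S.metric x (cplx x u) a : ℂ) =
        Complex.I * metricCoef S.metric x * toC u * starRingEnd ℂ (toC a) := by
    intro a
    rw [S.kahler.fundForm_eq, S.kahler.fundForm_eq, cplx_apply, map_smul]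
    apply Complex.ext <;> simp <;> ring
  rw [cubicForm, hH, h']
  simp only [map_mul, map_neg, Complex.conj_I, Complex.conj_conj, map_ofNat]
  linear_combination ((Complex.I / 2) * metricCoef S.metric x *
      starRingEnd ℂ (S.antiCoef x) * toC u * toC v * toC w) * Complex.I_mul_I

end SpecialKahlerStructure

/-! ### Curvature of the twisted connections -/

namespace SpecialKahler.Connection

variable {M : Type*} [TopologicalSpace M] [ChartedSpace ℂ M] [IsManifold 𝓘(ℂ) ω M]
variable (nabla : Connection M)

/-- The part of `∇` that anticommutes with `I`, on vector fields. -/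
def antiField (X Y : VField M) : VField M := fun x => nabla.anti Y x (X x)

/-- The part of `∇` that commutes with `I`, on vector fields. -/
def commCov (X Y : VField M) : VField M := (nabla.twist 0).cov X Y

lemma antiField_smooth {X Y : VField M} (hX : IsSmoothField X) (hY : IsSmoothField Y) :
    IsSmoothField (nabla.antiField X Y) :=
  ((IsSmoothField.cov nabla hX hY).smul (1 / 2)).add
    ((IsSmoothField.cov nabla hX (hY.smul Complex.I)).smul (Complex.I / 2))

lemma commCov_smooth {X Y : VField M} (hX : IsSmoothField X) (hY : IsSmoothField Y) :
    IsSmoothField (nabla.commCov X Y) := IsSmoothField.cov _ hX hY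

lemma commCov_smul {Y : VField M} (X : VField M) (hY : IsSmoothField Y) (c : ℂ) :
    nabla.commCov X (c • Y) = c • nabla.commCov X Y := by
  funext x
  exact nabla.twist_zero_smul (hY.differentiableAt x) c (X x)

lemma commCov_add {Y Z : VField M} (X : VField M) (hY : IsSmoothField Y) (hZ : IsSmoothField Z) :
    nabla.commCov X (Y + Z) = nabla.commCov X Y + nabla.commCov X Z := by
  funext x
  change (nabla.twist 0).toFun (Y + Z) x (X x) = _
  rw [toFun_add _ (hY.differentiableAt x) (hZ.differentiableAt x)]
  rfl

lemma antiField_smul {Y : VField M} (X : VField M) (hY : IsSmoothField Y) (c : ℂ) :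
    nabla.antiField X (c • Y) = (starRingEnd ℂ c) • nabla.antiField X Y := by
  funext x
  exact nabla.anti_smul (hY.differentiableAt x) c (X x)

lemma antiField_add {Y Z : VField M} (X : VField M) (hY : IsSmoothField Y)
    (hZ : IsSmoothField Z) :
    nabla.antiField X (Y + Z) = nabla.antiField X Y + nabla.antiField X Z := by
  funext x
  exact nabla.anti_add (hY.differentiableAt x) (hZ.differentiableAt x) (X x)

lemma cov_twist (mu : ℂ) (X Y : VField M) :
    (nabla.twist mu).cov X Y = nabla.commCov X Y + mu • nabla.antiField X Y := by
  funext x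
  exact nabla.twist_eq mu Y x (X x)

lemma cov_eq (X Y : VField M) :
    nabla.cov X Y = nabla.commCov X Y + nabla.antiField X Y := by
  funext x
  exact nabla.toFun_eq Y x (X x)

/-- The curvature of the part of `∇` that commutes with `I`. -/
def commCurv (X Y Z : VField M) : VField M :=
  nabla.commCov X (nabla.commCov Y Z) - nabla.commCov Y (nabla.commCov X Z)
    - nabla.commCov (bracket X Y) Z

/-- The exterior covariant derivative of the part `B` of `∇` that anticommutes with `I`. -/
def antiDeriv (X Y Z : VField M) : VField M :=
  nabla.commCov X (nabla.antiField Y Z) + nabla.antiField X (nabla.commCov Y Z)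
    - nabla.commCov Y (nabla.antiField X Z) - nabla.antiField Y (nabla.commCov X Z)
    - nabla.antiField (bracket X Y) Z

/-- The commutator `[B, B]` for the part `B` of `∇` that anticommutes with `I`. -/
def antiComm (X Y Z : VField M) : VField M :=
  nabla.antiField X (nabla.antiField Y Z) - nabla.antiField Y (nabla.antiField X Z)

/-- `D` commutes with the constant `μ`, while `B` conjugates it; hence the quadratic term carries `μ
conj(μ)`. -/
lemma curvature_twist (mu : ℂ) {X Y Z : VField M} (hX : IsSmoothField X) (hY : IsSmoothField Y)
    (hZ : IsSmoothField Z) :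
    (nabla.twist mu).cov X ((nabla.twist mu).cov Y Z)
      - (nabla.twist mu).cov Y ((nabla.twist mu).cov X Z)
      - (nabla.twist mu).cov (bracket X Y) Z =
    nabla.commCurv X Y Z + mu • nabla.antiDeriv X Y Z
      + (mu * starRingEnd ℂ mu) • nabla.antiComm X Y Z := by
  have hD : ∀ {X}, IsSmoothField X → IsSmoothField (nabla.commCov X Z) :=
    fun h => nabla.commCov_smooth h hZ
  have hA : ∀ {X}, IsSmoothField X → IsSmoothField (nabla.antiField X Z) :=
    fun h => nabla.antiField_smooth h hZ
  simp only [cov_twist]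
  rw [nabla.commCov_add X (hD hY) ((hA hY).smul mu), nabla.commCov_add Y (hD hX) ((hA hX).smul mu),
    nabla.antiField_add X (hD hY) ((hA hY).smul mu), nabla.antiField_add Y (hD hX) ((hA hX).smul mu),
    nabla.commCov_smul X (hA hY), nabla.commCov_smul Y (hA hX),
    nabla.antiField_smul X (hA hY), nabla.antiField_smul Y (hA hX), commCurv, antiDeriv, antiComm]
  module

lemma commCurv_smul {X Y Z : VField M} (hX : IsSmoothField X) (hY : IsSmoothField Y)
    (hZ : IsSmoothField Z) (c : ℂ) :
    nabla.commCurv X Y (c • Z) = c • nabla.commCurv X Y Z := by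
  simp only [commCurv, nabla.commCov_smul _ hZ]
  rw [nabla.commCov_smul X (nabla.commCov_smooth hY hZ),
    nabla.commCov_smul Y (nabla.commCov_smooth hX hZ)]
  module

lemma antiDeriv_smul {X Y Z : VField M} (hX : IsSmoothField X) (hY : IsSmoothField Y)
    (hZ : IsSmoothField Z) (c : ℂ) :
    nabla.antiDeriv X Y (c • Z) = (starRingEnd ℂ c) • nabla.antiDeriv X Y Z := by
  simp only [antiDeriv, nabla.commCov_smul _ hZ, nabla.antiField_smul _ hZ]
  rw [nabla.antiField_smul X (nabla.commCov_smooth hY hZ),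
    nabla.antiField_smul Y (nabla.commCov_smooth hX hZ),
    nabla.commCov_smul X (nabla.antiField_smooth hY hZ),
    nabla.commCov_smul Y (nabla.antiField_smooth hX hZ)]
  module

lemma antiComm_smul {X Y Z : VField M} (hX : IsSmoothField X) (hY : IsSmoothField Y)
    (hZ : IsSmoothField Z) (c : ℂ) :
    nabla.antiComm X Y (c • Z) = c • nabla.antiComm X Y Z := by
  simp only [antiComm, nabla.antiField_smul _ hZ]
  rw [nabla.antiField_smul X (nabla.antiField_smooth hY hZ),
    nabla.antiField_smul Y (nabla.antiField_smooth hX hZ), Complex.conj_conj]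
  module

variable {nabla}

/-- The curvature and `[B, B]` terms are complex linear in `Z` and `d_D B` is antilinear, so
flatness on `Z` and on `iZ` separates them. -/
lemma IsFlat.curvature_parts (h : nabla.IsFlat) {X Y Z : VField M} (hX : IsSmoothField X)
    (hY : IsSmoothField Y) (hZ : IsSmoothField Z) :
    nabla.antiDeriv X Y Z = 0 ∧ nabla.commCurv X Y Z + nabla.antiComm X Y Z = 0 := by
  have hone : ∀ X Y : VField M, nabla.cov X Y = (nabla.twist 1).cov X Y := by
    intro X Y
    rw [cov_eq, cov_twist, one_smul]
  have key : ∀ {Z : VField M}, IsSmoothField Z →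
      nabla.commCurv X Y Z + nabla.antiDeriv X Y Z + nabla.antiComm X Y Z = 0 := by
    intro Z hZ
    have h1 := nabla.curvature_twist 1 hX hY hZ
    rw [map_one, mul_one, one_smul, one_smul] at h1
    rw [← h1]
    funext x
    simp only [← hone]
    exact h X Y Z hX hY hZ x
  have k1 := key hZ
  have k2 := key (hZ.smul Complex.I)
  rw [nabla.commCurv_smul hX hY hZ, nabla.antiDeriv_smul hX hY hZ, nabla.antiComm_smul hX hY hZ,
    Complex.conj_I] at k2
  have k3 : nabla.antiDeriv X Y Z = 0 := by
    -- Adding `i` times the identity for `iZ` cancels the linear terms and doubles the antilinear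
    -- one.
    have : nabla.antiDeriv X Y Z = (1 / 2 : ℂ) •
        ((nabla.commCurv X Y Z + nabla.antiDeriv X Y Z + nabla.antiComm X Y Z)
        + Complex.I • (Complex.I • nabla.commCurv X Y Z + (-Complex.I) • nabla.antiDeriv X Y Z
          + Complex.I • nabla.antiComm X Y Z)) := by
      have hI := Complex.I_sq
      match_scalars <;> grind
    rw [this, k1, k2]
    simp
  refine ⟨k3, ?_⟩
  rw [k3, add_zero] at k1
  exact k1

lemma IsFlat.twist (h : nabla.IsFlat) {mu : ℂ} (hmu : ‖mu‖ = 1) : (nabla.twist mu).IsFlat := by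
  intro X Y Z hX hY hZ x
  have h1 := nabla.curvature_twist mu hX hY hZ
  obtain ⟨h2, h3⟩ := h.curvature_parts hX hY hZ
  have h4 : mu * starRingEnd ℂ mu = 1 := by
    rw [Complex.mul_conj, Complex.normSq_eq_norm_sq, hmu]
    simp
  rw [h2, h4, one_smul, smul_zero, add_zero, h3] at h1
  exact congrFun h1 x

end SpecialKahler.Connection

/-! ### What the metric determines, and rotation of the cubic form -/

namespace SpecialKahlerStructure

variable {M : Type*} [TopologicalSpace M] [ChartedSpace ℂ M] [IsManifold 𝓘(ℂ) ω M]

/-- At `x`, the derivative of `ω(E, iE)` along `X` is `2h Re(D_X E)`, and the function `ω(E, iE)`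
involves only the metric. -/
lemma re_twist_zero_eq {S S' : SpecialKahlerStructure M} (h : S.metric = S'.metric)
    {X E : VField M} (hX : IsSmoothField X) (hE : IsSmoothField E) {x : M} (hE1 : toC (E x) = 1) :
    (toC ((S.conn.twist 0).toFun E x (X x))).re = (toC ((S'.conn.twist 0).toFun E x (X x))).re := by
  have s1 := S.symplectic_twist 0 X E (Complex.I • E) hX hE (hE.smul _) x
  have s2 := S'.symplectic_twist 0 X E (Complex.I • E) hX hE (hE.smul _) x
  rw [← h, s1] at s2
  simp only [fundFormField, Connection.cov, S.kahler.fundForm_eq,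
    Connection.twist_zero_smul _ (hE.differentiableAt x), Pi.smul_apply, map_smul, smul_eq_mul, hE1,
    Complex.mul_re, Complex.mul_im, Complex.I_re, Complex.I_im, Complex.one_re,
    Complex.one_im] at s2
  have hpos := metricCoef_pos S.metric x
  refine mul_left_cancel₀ (mul_ne_zero two_ne_zero hpos.ne') ?_
  linear_combination s2

variable [T2Space M]

/-- The special Kähler structure with the same metric whose cubic form is rotated
by `conj mu`. -/
def twist (S : SpecialKahlerStructure M) (mu : ℂ) (hmu : ‖mu‖ = 1) : SpecialKahlerStructure M where
  metric := S.metric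
  conn := S.conn.twist mu
  kahler := S.kahler
  flat := S.flat.twist hmu
  symplectic := S.symplectic_twist mu
  torsionFree := S.torsion_twist mu
  special := by
    intro X Y hX hY
    funext x
    rw [S.conn.covCplx_twist mu (hY.differentiableAt x),
      S.conn.covCplx_twist mu (hX.differentiableAt x), S.special X Y hX hY]

lemma cubicForm_twist (S : SpecialKahlerStructure M) {mu : ℂ} (hmu : ‖mu‖ = 1) (x : M)
    (u v w : TangentSpace 𝓘(ℝ, ℂ) x) :
    (S.twist mu hmu).cubicForm x u v w = starRingEnd ℂ mu * S.cubicForm x u v w := by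
  have h : (S.twist mu hmu).antiCoef x = mu * S.antiCoef x := by
    have h1 := (S.twist mu hmu).conn.anti_eq_covCplx (FiberBundle.extend ℂ (unitVec x))
      (FiberBundle.extend ℂ (unitVec x)) x
    have h2 := S.conn.anti_eq_covCplx (FiberBundle.extend ℂ (unitVec x))
      (FiberBundle.extend ℂ (unitVec x)) x
    have h3 := S.conn.covCplx_twist mu (X := FiberBundle.extend ℂ (unitVec x))
      (Y := FiberBundle.extend ℂ (unitVec x)) (x := x)
      (FiberBundle.mdifferentiableAt_extend ..)
    rw [FiberBundle.extend_apply_self] at h1 h2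
    rw [antiCoef, antiCoef, h1, h2]
    change toC ((Complex.I / 2) • (S.conn.twist mu).covCplx _ _ x) = _
    rw [h3]
    simp only [map_smul, smul_eq_mul]
    ring
  rw [cubicForm_eq, cubicForm_eq, h, map_mul]
  change -(Complex.I / 2) * metricCoef S.metric x * _ * _ * _ * _ = _
  ring

/-- The difference `T` of the two connections is complex linear in the field and, both being
torsion-free, symmetric: it is `t dz dz`. Compatibility with `ω` gives `Re(ct) = 0` for all `c`, so
`t = 0`. -/
lemma twist_zero_eq {S S' : SpecialKahlerStructure M} (h : S.metric = S'.metric) :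
    S.conn.twist 0 = S'.conn.twist 0 := by
  suffices H : ∀ (Y : VField M) (x : M), DifferentiableFieldAt Y x →
      (S.conn.twist 0).toFun Y x = (S'.conn.twist 0).toFun Y x by
    apply Connection.ext
    funext Y x
    -- Where `Y` is not differentiable, both connections take the normalized value `0`.
    by_cases hY : DifferentiableFieldAt Y x
    · exact H Y x hY
    · exact ((S.conn.twist 0).normalized Y x hY).trans ((S'.conn.twist 0).normalized Y x hY).symm
  intro Y x hY
  obtain ⟨E, hE, hE1⟩ := exists_smoothField_one x
  have hEx := hE.differentiableAt x
  have e : ∀ v : TangentSpace 𝓘(ℝ, ℂ) x, v = toC v • E x := by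
    intro v
    apply toC.injective
    rw [map_smul, hE1, smul_eq_mul, mul_one]
  let T := IsCovariantDerivativeOn.difference (S.conn.twist 0).isCovariantDerivativeOnUniv
    (S'.conn.twist 0).isCovariantDerivativeOnUniv x
  have hT : ∀ {Y : VField M}, DifferentiableFieldAt Y x →
      T (Y x) = (S.conn.twist 0).toFun Y x - (S'.conn.twist 0).toFun Y x := fun hY =>
    IsCovariantDerivativeOn.difference_apply (S.conn.twist 0).isCovariantDerivativeOnUniv
      (S'.conn.twist 0).isCovariantDerivativeOnUniv trivial hY
  have hTc : ∀ (c : ℂ) (v : TangentSpace 𝓘(ℝ, ℂ) x), T (c • E x) v = c • T (E x) v := by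
    intro c v
    have h1 := hT (hEx.smul c)
    rw [Pi.smul_apply] at h1
    rw [h1, hT hEx, _root_.sub_apply, _root_.sub_apply, S.conn.twist_zero_smul hEx,
      S'.conn.twist_zero_smul hEx, smul_sub]
  have hTs : ∀ c d : ℂ, T (c • E x) (d • E x) = T (d • E x) (c • E x) := by
    intro c d
    have t1 := (CovariantDerivative.torsion_eq_zero_iff _).1 (S.torsion_twist 0)
      (hEx.smul c) (hEx.smul d)
    have t2 := (CovariantDerivative.torsion_eq_zero_iff _).1 (S'.torsion_twist 0)
      (hEx.smul c) (hEx.smul d)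
    have h1 := hT (hEx.smul c)
    have h2 := hT (hEx.smul d)
    rw [Pi.smul_apply] at h1 h2
    have h3 := t1.trans t2.symm
    rw [Pi.smul_apply, Pi.smul_apply] at h3
    rw [h1, h2, _root_.sub_apply, _root_.sub_apply]
    have h4 := congrArg Neg.neg h3
    rw [neg_sub, neg_sub] at h4
    exact sub_eq_sub_iff_sub_eq_sub.2 h4
  have hTE : ∀ c : ℂ, T (E x) (c • E x) = c • T (E x) (E x) := by
    intro c
    have := hTs 1 c
    rw [one_smul] at this
    rw [this, hTc]
  have hre : ∀ c : ℂ, (c * toC (T (E x) (E x))).re = 0 := by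
    intro c
    have h1 := re_twist_zero_eq h (hE.smul c) hE hE1
    rw [← smul_eq_mul, ← map_smul, ← hTE, hT hEx, _root_.sub_apply, map_sub, Complex.sub_re,
      sub_eq_zero]
    exact h1
  have h0 : T (E x) (E x) = 0 := by
    apply toC.injective
    have h1 := hre 1
    have h2 := hre Complex.I
    rw [one_mul] at h1
    rw [Complex.I_mul_re, neg_eq_zero] at h2
    rw [map_zero]
    exact Complex.ext h1 h2
  ext v
  rw [← sub_eq_zero, ← _root_.sub_apply, ← hT hY, e (Y x), e v, hTc, hTE, h0, smul_zero, smul_zero]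

lemma conn_eq_of_antiCoef {S S' : SpecialKahlerStructure M} (h : S.metric = S'.metric)
    (hb : S.antiCoef = S'.antiCoef) : S = S' := by
  refine SpecialKahlerStructure.ext h ?_
  apply Connection.ext
  funext Y x
  by_cases hY : DifferentiableFieldAt Y x
  · ext v
    rw [S.conn.toFun_eq, S'.conn.toFun_eq, twist_zero_eq h]
    congr 1
    apply toC.injective
    rw [toC_anti hY, toC_anti hY, hb]
  · exact (S.conn.normalized Y x hY).trans (S'.conn.normalized Y x hY).symm

/-- A special Kähler structure is determined by its metric and its cubic form. -/
theorem eq_of_cubicForm_eq {S S' : SpecialKahlerStructure M} (h : S.metric = S'.metric)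
    (hc : ∀ x u v w, S.cubicForm x u v w = S'.cubicForm x u v w) : S = S' := by
  apply conn_eq_of_antiCoef h
  funext x
  have h1 := hc x (unitVec x) (unitVec x) (unitVec x)
  have hu : toC (unitVec x) = 1 := by simp [unitVec]
  rw [cubicForm_eq, cubicForm_eq, hu, ← h] at h1
  have hpos : (metricCoef S.metric x : ℂ) ≠ 0 :=
    Complex.ofReal_ne_zero.2 (metricCoef_pos S.metric x).ne'
  apply (starRingEnd ℂ).injective
  refine mul_left_cancel₀ (mul_ne_zero (a := -(Complex.I / 2)) (by simp) hpos) ?_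
  linear_combination h1

/-- The metric determines the norm of the cubic form. -/
theorem norm_antiCoef_eq {S S' : SpecialKahlerStructure M} (h : S.metric = S'.metric) (x : M) :
    ‖S.antiCoef x‖ = ‖S'.antiCoef x‖ := by
  obtain ⟨E, hE, hE1⟩ := exists_smoothField_one x
  have hIE := hE.smul Complex.I
  -- Both terms of `[B, B](E, iE)E` contribute `i |b|^2`.
  have hcomm : ∀ S : SpecialKahlerStructure M,
      toC (S.conn.antiComm E (Complex.I • E) E x) =
        2 * Complex.I * (‖S.antiCoef x‖ ^ 2 : ℝ) := by
    intro S
    have hA : ∀ {X Y : VField M}, IsSmoothField Y → toC (S.conn.antiField X Y x) =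
        S.antiCoef x * starRingEnd ℂ (toC (X x)) * starRingEnd ℂ (toC (Y x)) :=
      fun hY => toC_anti (hY.differentiableAt x) _
    rw [Connection.antiComm, Pi.sub_apply, map_sub, hA (S.conn.antiField_smooth hIE hE), hA hE,
      hA (S.conn.antiField_smooth hE hE), hA hE, Pi.smul_apply, map_smul, hE1,
      ← Complex.normSq_eq_norm_sq, ← Complex.mul_conj]
    simp only [map_mul, map_neg, smul_eq_mul, map_one, mul_one, Complex.conj_I]
    ring
  have h1 := (S.flat.curvature_parts hE hIE hE).2
  have h2 := (S'.flat.curvature_parts hE hIE hE).2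
  -- The curvature of `D` depends only on `D`, hence only on the metric.
  have h3 : S.conn.commCurv E (Complex.I • E) E = S'.conn.commCurv E (Complex.I • E) E := by
    simp only [Connection.commCurv, Connection.commCov, twist_zero_eq h]
  rw [h3, ← h2] at h1
  have h4 := congrArg toC (congrFun (add_left_cancel h1) x)
  rw [hcomm, hcomm] at h4
  have h5 := mul_left_cancel₀ (by simp : (2 * Complex.I : ℂ) ≠ 0) h4
  have h6 := Complex.ofReal_injective h5
  exact (pow_left_inj₀ (norm_nonneg _) (norm_nonneg _) two_ne_zero).1 h6

end SpecialKahlerStructure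

/-! ### Holomorphic functions of equal modulus, and derivatives in a chart -/

namespace SpecialKahler

variable {M : Type*} [TopologicalSpace M] [ChartedSpace ℂ M]

/-- Coefficients in the preferred charts need not vary continuously with the point; the local factor
`k` converts them to a fixed chart. The quotient has modulus one where defined, so it is locally
constant by the maximum principle, and the identity theorem propagates the relation. -/
lemma exists_unit_mul_eq [PreconnectedSpace M] {p q : M → ℂ}
    (hnorm : ∀ x, ‖p x‖ = ‖q x‖)
    (hloc : ∀ x₀, ∃ k : M → ℂ, (∀ᶠ y in 𝓝 x₀, k y ≠ 0) ∧
      AnalyticAt ℂ ((k * p) ∘ (extChartAt 𝓘(ℝ, ℂ) x₀).symm) (extChartAt 𝓘(ℝ, ℂ) x₀ x₀) ∧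
      AnalyticAt ℂ ((k * q) ∘ (extChartAt 𝓘(ℝ, ℂ) x₀).symm) (extChartAt 𝓘(ℝ, ℂ) x₀ x₀)) :
    ∃ c : ℂ, ‖c‖ = 1 ∧ ∀ x, q x = c * p x := by
  by_cases hp : ∀ x, p x = 0
  · refine ⟨1, norm_one, fun x => ?_⟩
    have := hnorm x
    rw [hp, norm_zero] at this
    rw [hp, mul_zero]
    exact norm_eq_zero.1 this.symm
  push Not at hp
  obtain ⟨x₁, hx₁⟩ := hp
  have hchart : ∀ x₀ : M, Tendsto (extChartAt 𝓘(ℝ, ℂ) x₀) (𝓝 x₀) (𝓝 (extChartAt 𝓘(ℝ, ℂ) x₀ x₀)) :=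
    fun x₀ => continuousAt_extChartAt x₀
  have hinv : ∀ x₀ : M, ∀ᶠ y in 𝓝 x₀,
      (extChartAt 𝓘(ℝ, ℂ) x₀).symm (extChartAt 𝓘(ℝ, ℂ) x₀ y) = y := fun x₀ => by
    filter_upwards [extChartAt_source_mem_nhds (I := 𝓘(ℝ, ℂ)) x₀] with y hy
    exact (extChartAt 𝓘(ℝ, ℂ) x₀).left_inv hy
  have hc : ‖q x₁ / p x₁‖ = 1 := by
    rw [norm_div, hnorm, div_self]
    rw [← hnorm]
    exact norm_ne_zero_iff.2 hx₁
  refine ⟨q x₁ / p x₁, hc, ?_⟩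
  have hstart : ∀ᶠ y in 𝓝 x₁, q y = q x₁ / p x₁ * p y := by
    obtain ⟨k, hk, hf, hg⟩ := hloc x₁
    have hk1 := hk.self_of_nhds
    have hf0 : ((k * p) ∘ (extChartAt 𝓘(ℝ, ℂ) x₁).symm) (extChartAt 𝓘(ℝ, ℂ) x₁ x₁) ≠ 0 := by
      simp [hk1, hx₁]
    have hr := hg.div hf hf0
    have hne := hf.continuousAt.eventually_ne hf0
    have hn : ∀ᶠ z in 𝓝 (extChartAt 𝓘(ℝ, ℂ) x₁ x₁),
        ‖(((k * q) ∘ (extChartAt 𝓘(ℝ, ℂ) x₁).symm) / ((k * p) ∘ (extChartAt 𝓘(ℝ, ℂ) x₁).symm)) z‖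
          = 1 := by
      filter_upwards [hne] with z hz
      rw [Pi.div_apply, norm_div]
      simp only [Function.comp_apply, Pi.mul_apply, norm_mul, ← hnorm]
      simp only [Function.comp_apply, Pi.mul_apply] at hz
      rw [div_self]
      rw [← norm_mul]
      exact norm_ne_zero_iff.2 hz
    have hmax := Complex.eventually_eq_of_isLocalMax_norm
      ((hr.eventually_analyticAt).mono fun z hz => hz.differentiableAt)
      (show IsLocalMax _ _ by
        filter_upwards [hn] with z hz
        simp only [Function.comp_apply]
        rw [hz, hn.self_of_nhds])
    filter_upwards [(hchart x₁).eventually (hmax.and hne), hinv x₁, hk] with y hy hy' hky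
    obtain ⟨h1, h2⟩ := hy
    simp only [Pi.div_apply, Function.comp_apply, Pi.mul_apply, hy', extChartAt_to_inv] at h1 h2
    rw [mul_div_mul_left _ _ hk1, mul_div_mul_left _ _ hky] at h1
    have hpy : p y ≠ 0 := fun h => h2 (by rw [h, mul_zero])
    rw [← h1, div_mul_cancel₀ _ hpy]
  -- The condition is imposed on a neighbourhood, so the set is open by construction; closedness is
  -- the identity theorem.
  have hclopen : IsClopen {x | ∀ᶠ y in 𝓝 x, q y = q x₁ / p x₁ * p y} := by
    constructor
    · rw [← isOpen_compl_iff, isOpen_iff_mem_nhds]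
      intro x hx
      obtain ⟨k, hk, hf, hg⟩ := hloc x
      rcases (hg.sub (analyticAt_const.mul hf :
          AnalyticAt ℂ (fun z => q x₁ / p x₁ * ((k * p) ∘ (extChartAt 𝓘(ℝ, ℂ) x).symm) z)
            _)).eventually_eq_zero_or_eventually_ne_zero with h | h
      · refine absurd ?_ hx
        filter_upwards [(hchart x).eventually h, hinv x, hk] with y hy hy' hky
        simp only [Pi.sub_apply, Function.comp_apply, Pi.mul_apply, hy'] at hy
        refine mul_left_cancel₀ hky ?_
        linear_combination hy
      -- An isolated zero of the difference at `x` keeps all nearby points other than `x` out of the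
      -- set.
      · rw [eventually_nhdsWithin_iff] at h
        filter_upwards [(hchart x).eventually h, hinv x] with y hy hy' hmem
        by_cases hxy : y = x
        · exact hx (hxy ▸ hmem)
        · have hne : extChartAt 𝓘(ℝ, ℂ) x y ∈ ({extChartAt 𝓘(ℝ, ℂ) x x} : Set ℂ)ᶜ := by
            intro h'
            apply hxy
            rw [← hy', Set.mem_singleton_iff.1 h', extChartAt_to_inv]
          apply hy hne
          have := hmem.self_of_nhds
          simp only [Pi.sub_apply, Function.comp_apply, Pi.mul_apply, hy', this]
          ring
    · rw [isOpen_iff_mem_nhds]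
      intro x hx
      exact eventually_eventually_nhds.2 hx
  intro x
  have huniv := hclopen.eq_univ ⟨x₁, hstart⟩
  have hx : x ∈ {x | ∀ᶠ y in 𝓝 x, q y = q x₁ / p x₁ * p y} := huniv ▸ Set.mem_univ x
  exact hx.self_of_nhds

variable [IsManifold 𝓘(ℂ) ω M]

lemma contMDiff_fundFormField (g : Metric M) {X Y : VField M} (hX : IsSmoothField X)
    (hY : IsSmoothField Y) : ContMDiff 𝓘(ℝ, ℂ) 𝓘(ℝ) ∞ (fundFormField g X Y) := by
  have h : ContMDiff 𝓘(ℝ, ℂ) (𝓘(ℝ, ℂ).prod 𝓘(ℝ)) ∞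
      (fun m => TotalSpace.mk' ℝ (E := Bundle.Trivial M ℝ) m
        (g.inner m ((Complex.I • X) m) (Y m))) := by
    apply ContMDiff.clm_bundle_apply₂ (F₁ := ℂ) (F₂ := ℂ)
    · exact g.contMDiff
    · exact hX.smul Complex.I
    · exact hY
  intro x
  have hx := h x
  simp only [contMDiffAt_totalSpace] at hx
  exact hx.2

lemma fderiv_comp_extChartAt_symm {u : M → ℝ} {x₀ y : M} (hy : y ∈ (chartAt ℂ x₀).source)
    (hu : MDifferentiableAt 𝓘(ℝ, ℂ) 𝓘(ℝ) u y) (c : ℂ) :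
    DifferentiableAt ℝ (u ∘ (extChartAt 𝓘(ℝ, ℂ) x₀).symm) (extChartAt 𝓘(ℝ, ℂ) x₀ y) ∧
    fderiv ℝ (u ∘ (extChartAt 𝓘(ℝ, ℂ) x₀).symm) (extChartAt 𝓘(ℝ, ℂ) x₀ y) c =
      mfderiv 𝓘(ℝ, ℂ) 𝓘(ℝ) u y (c • coordField x₀ y) := by
  have hy' : y ∈ (extChartAt 𝓘(ℝ, ℂ) x₀).source := by simpa using hy
  have hs : MDifferentiableAt 𝓘(ℝ, ℂ) 𝓘(ℝ, ℂ) (extChartAt 𝓘(ℝ, ℂ) x₀).symm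
      (extChartAt 𝓘(ℝ, ℂ) x₀ y) := by
    have := mdifferentiableWithinAt_extChartAt_symm (I := 𝓘(ℝ, ℂ))
      ((extChartAt 𝓘(ℝ, ℂ) x₀).map_source hy')
    simpa [mdifferentiableWithinAt_univ] using this
  have hu' : MDifferentiableAt 𝓘(ℝ, ℂ) 𝓘(ℝ) u
      ((extChartAt 𝓘(ℝ, ℂ) x₀).symm (extChartAt 𝓘(ℝ, ℂ) x₀ y)) := by
    rwa [(extChartAt 𝓘(ℝ, ℂ) x₀).left_inv hy']
  have hG : MDifferentiableAt 𝓘(ℝ, ℂ) 𝓘(ℝ) (u ∘ (extChartAt 𝓘(ℝ, ℂ) x₀).symm)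
      (extChartAt 𝓘(ℝ, ℂ) x₀ y) := hu'.comp _ hs
  refine ⟨hG.differentiableAt, ?_⟩
  have hφ : MDifferentiableAt 𝓘(ℝ, ℂ) 𝓘(ℝ, ℂ) (extChartAt 𝓘(ℝ, ℂ) x₀) y :=
    mdifferentiableAt_extChartAt hy
  have hcomp := hG.hasMFDerivAt.comp y hφ.hasMFDerivAt
  have heq : u =ᶠ[𝓝 y] (u ∘ (extChartAt 𝓘(ℝ, ℂ) x₀).symm) ∘ (extChartAt 𝓘(ℝ, ℂ) x₀) := by
    filter_upwards [(chartAt ℂ x₀).open_source.mem_nhds hy] with z hz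
    simp only [Function.comp_apply]
    rw [(extChartAt 𝓘(ℝ, ℂ) x₀).left_inv (by simpa using hz)]
  have h1 := (hcomp.congr_of_eventuallyEq heq).mfderiv
  have h2 : mfderiv 𝓘(ℝ, ℂ) 𝓘(ℝ, ℂ) (extChartAt 𝓘(ℝ, ℂ) x₀) y (c • coordField x₀ y) = c := by
    apply toC.injective
    refine (congrArg toC (mfderiv_extChartAt_smul hy c (coordField x₀ y))).trans ?_
    rw [map_smul, mfderiv_coordField hy]
    exact mul_one c
  rw [h1, mfderiv_eq_fderiv]
  exact (congrArg (fderiv ℝ (u ∘ (extChartAt 𝓘(ℝ, ℂ) x₀).symm) (extChartAt 𝓘(ℝ, ℂ) x₀ y)) h2).symm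

end SpecialKahler

/-! ### Holomorphicity of the cubic form -/

namespace SpecialKahlerStructure

variable {M : Type*} [TopologicalSpace M] [ChartedSpace ℂ M] [IsManifold 𝓘(ℂ) ω M]
variable (S : SpecialKahlerStructure M)

lemma lieDer_fundFormField {X Y Z : VField M} (hX : IsSmoothField X) (hY : IsSmoothField Y)
    (hZ : IsSmoothField Z) (x : M) :
    lieDer X (fundFormField S.metric Y Z) x =
      fundFormField S.metric (S.conn.commCov X Y) Z x
        + fundFormField S.metric Y (S.conn.commCov X Z) x :=
  S.symplectic_twist 0 X Y Z hX hY hZ x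

variable [T2Space M]

/-- When `X` and `iX` commute, vanishing torsion gives `D_{iX} X = D_X(iX)`: the field is
holomorphic for `D`. -/
lemma commCov_I_smul {X : VField M} (hX : IsSmoothField X) {x : M}
    (hb : bracket X (Complex.I • X) x = 0) :
    S.conn.commCov (Complex.I • X) X x = Complex.I • S.conn.commCov X X x := by
  have h := (CovariantDerivative.torsion_eq_zero_iff _).1 (S.torsion_twist 0)
    (hX.differentiableAt x) ((hX.smul Complex.I).differentiableAt x)
  have h' : S.conn.commCov X (Complex.I • X) x - S.conn.commCov (Complex.I • X) X x = 0 :=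
    h.trans hb
  rw [S.conn.commCov_smul X hX] at h'
  exact (sub_eq_zero.1 h').symm

/-- This is `d_D B(X, iX)X = 0`: the terms `B(X, D_{iX} X)` and `B(iX, D_X X)` cancel, and `B(iX, X)
= -i B(X, X)`. So `B(X, X)` is antiholomorphic for `D`. -/
lemma commCov_I_smul_antiField {X : VField M} (hX : IsSmoothField X) {x : M}
    (hb : bracket X (Complex.I • X) x = 0) :
    S.conn.commCov (Complex.I • X) (S.conn.antiField X X) x =
      -(Complex.I • S.conn.commCov X (S.conn.antiField X X) x) := by
  have hIX := hX.smul Complex.I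
  have h := congrFun (S.flat.curvature_parts hX hIX hX).1 x
  have hsymm : S.conn.antiField (Complex.I • X) X = (-Complex.I) • S.conn.antiField X X := by
    rw [← Complex.conj_I, ← S.conn.antiField_smul X hX]
    funext y
    exact anti_symm_of_smooth hIX hX y
  have h1 : S.conn.antiField X (S.conn.commCov (Complex.I • X) X) x =
      S.conn.antiField (Complex.I • X) (S.conn.commCov X X) x := by
    apply toC.injective
    have e1 := toC_anti (S := S) ((S.conn.commCov_smooth hIX hX).differentiableAt x) (X x)
    have e2 := toC_anti (S := S) ((S.conn.commCov_smooth hX hX).differentiableAt x)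
      ((Complex.I • X) x)
    refine e1.trans (Eq.trans ?_ e2.symm)
    rw [S.commCov_I_smul hX hb, Pi.smul_apply, map_smul toC, map_smul toC]
    simp only [smul_eq_mul, map_mul]
    ring
  have h2 : S.conn.antiField (bracket X (Complex.I • X)) X x = 0 := by
    rw [Connection.antiField, hb, map_zero]
  rw [Connection.antiDeriv, hsymm, S.conn.commCov_smul X (S.conn.antiField_smooth hX hX)] at h
  simp only [Pi.sub_apply, Pi.add_apply, Pi.smul_apply, h1, h2, Pi.zero_apply] at h
  rw [sub_zero, sub_right_comm, add_sub_cancel_right, sub_eq_zero] at h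
  rw [← h, neg_smul]

/-- `D` preserves `ω`, `X` is holomorphic and `B(X, X)` antiholomorphic; these are the
Cauchy–Riemann equations for `ω(X, B(X, X)) - i ω(iX, B(X, X))`, a constant multiple of `Ξ(X, X,
X)`. -/
lemma fundFormField_cauchyRiemann {X : VField M} (hX : IsSmoothField X) {x : M}
    (hb : bracket X (Complex.I • X) x = 0) :
    lieDer (Complex.I • X) (fundFormField S.metric X (S.conn.antiField X X)) x =
      lieDer X (fundFormField S.metric (Complex.I • X) (S.conn.antiField X X)) x ∧
    lieDer (Complex.I • X) (fundFormField S.metric (Complex.I • X) (S.conn.antiField X X)) x =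
      -lieDer X (fundFormField S.metric X (S.conn.antiField X X)) x := by
  have hIX := hX.smul Complex.I
  have hV := S.conn.antiField_smooth hX hX
  rw [S.lieDer_fundFormField hIX hX hV, S.lieDer_fundFormField hX hIX hV,
    S.lieDer_fundFormField hIX hIX hV, S.lieDer_fundFormField hX hX hV,
    S.conn.commCov_smul _ hX, S.conn.commCov_smul _ hX]
  simp only [fundFormField, S.kahler.fundForm_eq, Pi.smul_apply, S.commCov_I_smul hX hb,
    S.commCov_I_smul_antiField hX hb, map_smul, map_neg, smul_eq_mul, Complex.mul_re,
    Complex.mul_im, Complex.neg_re, Complex.neg_im, Complex.I_re, Complex.I_im]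
  constructor <;> ring

lemma cubicForm_field_eq {X : VField M} (hX : IsSmoothField X) (x : M) :
    S.cubicForm x (X x) (X x) (X x) =
      -(1 / 2) * ((fundFormField S.metric X (S.conn.antiField X X) x : ℂ)
        - Complex.I * (fundFormField S.metric (Complex.I • X) (S.conn.antiField X X) x : ℂ)) := by
  have hV : toC (S.conn.antiField X X x) =
      S.antiCoef x * starRingEnd ℂ (toC (X x)) * starRingEnd ℂ (toC (X x)) :=
    toC_anti (hX.differentiableAt x) (X x)
  have hH : (fundFormField S.metric X (S.conn.antiField X X) x : ℂ)
        - Complex.I * (fundFormField S.metric (Complex.I • X) (S.conn.antiField X X) x : ℂ) =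
      Complex.I * metricCoef S.metric x * toC (X x)
        * starRingEnd ℂ (toC (S.conn.antiField X X x)) := by
    rw [fundFormField, fundFormField, S.kahler.fundForm_eq, S.kahler.fundForm_eq, Pi.smul_apply,
      map_smul]
    apply Complex.ext <;> simp <;> ring
  rw [hH, hV, cubicForm_eq]
  simp only [map_mul, Complex.conj_conj]
  ring

/-- The cubic form of a special Kähler structure is holomorphic. -/
theorem analyticAt_cubicForm {X : VField M} (hX : IsSmoothField X) {x₀ : M}
    (hX₀ : X =ᶠ[𝓝 x₀] coordField x₀) :
    AnalyticAt ℂ ((fun y => S.cubicForm y (X y) (X y) (X y)) ∘ (extChartAt 𝓘(ℝ, ℂ) x₀).symm)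
      (extChartAt 𝓘(ℝ, ℂ) x₀ x₀) := by
  have hIX := hX.smul Complex.I
  have hV := S.conn.antiField_smooth hX hX
  set u := fundFormField S.metric X (S.conn.antiField X X) with hu_def
  set w := fundFormField S.metric (Complex.I • X) (S.conn.antiField X X) with hw_def
  have hu : ∀ y, MDifferentiableAt 𝓘(ℝ, ℂ) 𝓘(ℝ) u y := fun y =>
    (contMDiff_fundFormField S.metric hX hV y).mdifferentiableAt (by simp)
  have hw : ∀ y, MDifferentiableAt 𝓘(ℝ, ℂ) 𝓘(ℝ) w y := fun y =>
    (contMDiff_fundFormField S.metric hIX hV y).mdifferentiableAt (by simp)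
  have hξ : (fun y => S.cubicForm y (X y) (X y) (X y)) ∘ (extChartAt 𝓘(ℝ, ℂ) x₀).symm =
      fun z => -(1 / 2) * (((u ∘ (extChartAt 𝓘(ℝ, ℂ) x₀).symm) z : ℂ)
        - Complex.I * ((w ∘ (extChartAt 𝓘(ℝ, ℂ) x₀).symm) z : ℂ)) := by
    funext z
    exact S.cubicForm_field_eq hX _
  rw [hξ, Complex.analyticAt_iff_eventually_differentiableAt]
  have hgood : ∀ᶠ y in 𝓝 x₀, y ∈ (chartAt ℂ x₀).source ∧ X =ᶠ[𝓝 y] coordField x₀ :=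
    (Filter.eventually_of_mem ((chartAt ℂ x₀).open_source.mem_nhds (mem_chart_source ℂ x₀))
      fun _ => id).and (eventually_eventually_nhds.2 hX₀)
  have hsymm : Tendsto (extChartAt 𝓘(ℝ, ℂ) x₀).symm (𝓝 (extChartAt 𝓘(ℝ, ℂ) x₀ x₀)) (𝓝 x₀) := by
    have := continuousAt_extChartAt_symm (I := 𝓘(ℝ, ℂ)) x₀
    rwa [ContinuousAt, extChartAt_to_inv] at this
  filter_upwards [hsymm.eventually hgood, extChartAt_target_mem_nhds (I := 𝓘(ℝ, ℂ)) x₀]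
    with z hz hzt
  obtain ⟨hy, hXy⟩ := hz
  set y := (extChartAt 𝓘(ℝ, ℂ) x₀).symm z with hy_def
  have hzy : z = extChartAt 𝓘(ℝ, ℂ) x₀ y := ((extChartAt 𝓘(ℝ, ℂ) x₀).right_inv hzt).symm
  have hb : bracket X (Complex.I • X) y = 0 := by
    rw [← coordField_bracket hy]
    apply Filter.EventuallyEq.mlieBracket_vectorField_eq hXy
    filter_upwards [hXy] with t ht
    rw [Pi.smul_apply, Pi.smul_apply, ht]
  obtain ⟨c1, c2⟩ := S.fundFormField_cauchyRiemann hX hb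
  have du := fderiv_comp_extChartAt_symm hy (hu y)
  have dw := fderiv_comp_extChartAt_symm hy (hw y)
  rw [← hXy.self_of_nhds, ← hzy] at du dw
  have du1 := (du 1).2
  have dw1 := (dw 1).2
  have duI := (du Complex.I).2
  have dwI := (dw Complex.I).2
  rw [one_smul] at du1 dw1
  have c1' : fderiv ℝ (u ∘ (extChartAt 𝓘(ℝ, ℂ) x₀).symm) z Complex.I =
      fderiv ℝ (w ∘ (extChartAt 𝓘(ℝ, ℂ) x₀).symm) z 1 := duI.trans (c1.trans dw1.symm)
  have c2' : fderiv ℝ (w ∘ (extChartAt 𝓘(ℝ, ℂ) x₀).symm) z Complex.I =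
      -fderiv ℝ (u ∘ (extChartAt 𝓘(ℝ, ℂ) x₀).symm) z 1 :=
    dwI.trans (c2.trans (congrArg Neg.neg du1.symm))
  have Du := Complex.ofRealCLM.hasFDerivAt.comp z (du 1).1.hasFDerivAt
  have Dw := Complex.ofRealCLM.hasFDerivAt.comp z (dw 1).1.hasFDerivAt
  have D := (Du.sub (Dw.const_mul Complex.I)).const_mul (-(1 / 2) : ℂ)
  have D' : HasFDerivAt (fun z => -(1 / 2) * (((u ∘ (extChartAt 𝓘(ℝ, ℂ) x₀).symm) z : ℂ)
        - Complex.I * ((w ∘ (extChartAt 𝓘(ℝ, ℂ) x₀).symm) z : ℂ))) _ z := D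
  -- It remains to see that the real derivative sends `i` to `i` times its value at `1`.
  refine (D'.complexOfReal_hasFDerivAt ?_).differentiableAt
  simp only [_root_.smul_apply, _root_.sub_apply, ContinuousLinearMap.comp_apply, c1', c2',
    Complex.ofRealCLM_apply, smul_eq_mul, Complex.ofReal_neg]
  linear_combination (-(1 / 2) *
    (fderiv ℝ (w ∘ (extChartAt 𝓘(ℝ, ℂ) x₀).symm) z 1 : ℂ)) * Complex.I_mul_I

/-- Two special Kähler structures with the same metric have cubic forms that differ by a constant
of modulus one. -/
theorem exists_cubicForm_eq [PreconnectedSpace M] {S S' : SpecialKahlerStructure M}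
    (h : S.metric = S'.metric) :
    ∃ c : ℂ, ‖c‖ = 1 ∧ ∀ x u v w, S'.cubicForm x u v w = c * S.cubicForm x u v w := by
  have hform : ∀ (S : SpecialKahlerStructure M) (x : M) (u v w : TangentSpace 𝓘(ℝ, ℂ) x),
      S.cubicForm x u v w =
        (toC u * toC v * toC w) * S.cubicForm x (unitVec x) (unitVec x) (unitVec x) := by
    intro S x u v w
    have hu : toC (unitVec x) = 1 := by simp [unitVec]
    rw [cubicForm_eq, cubicForm_eq, hu]
    ring
  obtain ⟨c, hc, hcc⟩ := exists_unit_mul_eq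
    (p := fun x => S.cubicForm x (unitVec x) (unitVec x) (unitVec x))
    (q := fun x => S'.cubicForm x (unitVec x) (unitVec x) (unitVec x)) (by
      intro x
      simp only [cubicForm_eq, norm_mul, ← h, RCLike.norm_conj, norm_antiCoef_eq h x]) (by
      intro x₀
      obtain ⟨X, hX, hX₀⟩ := exists_smoothField x₀
      -- The cube of the coordinate of `X` converts the preferred-chart coefficient into `Ξ(X, X,
      -- X)`, which is holomorphic near `x₀`.
      refine ⟨fun y => toC (X y) * toC (X y) * toC (X y), ?_, ?_, ?_⟩
      · filter_upwards [hX₀, (chartAt ℂ x₀).open_source.mem_nhds (mem_chart_source ℂ x₀)]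
          with y hy hys
        have h0 : toC (X y) ≠ 0 := by
          intro h0
          have h1 := mfderiv_coordField hys
          rw [← hy, toC.map_eq_zero_iff.1 h0, map_zero, map_zero] at h1
          exact zero_ne_one h1
        exact mul_ne_zero (mul_ne_zero h0 h0) h0
      · convert S.analyticAt_cubicForm hX hX₀ using 2
        funext y
        exact (hform S y _ _ _).symm
      · convert S'.analyticAt_cubicForm hX hX₀ using 2
        funext y
        exact (hform S' y _ _ _).symm)
  refine ⟨c, hc, fun x u v w => ?_⟩
  rw [hform S', hform S, hcc x]
  ring

/-! ### The circle of structures with a given metric -/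

theorem existsUnique_cubicForm_eq (S : SpecialKahlerStructure M) {c : ℂ} (hc : ‖c‖ = 1) :
    ∃! S' : SpecialKahlerStructure M, S'.metric = S.metric ∧
      ∀ x u v w, S'.cubicForm x u v w = c * S.cubicForm x u v w := by
  -- The cubic form contains `conj(b)`, so multiplying it by `c` requires twisting by `conj(c)`.
  have hc' : ‖starRingEnd ℂ c‖ = 1 := by rwa [RCLike.norm_conj]
  refine ⟨S.twist _ hc', ⟨rfl, fun x u v w => ?_⟩, ?_⟩
  · rw [S.cubicForm_twist, Complex.conj_conj]
  · rintro S' ⟨h1, h2⟩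
    refine eq_of_cubicForm_eq h1 fun x u v w => ?_
    rw [h2, S.cubicForm_twist, Complex.conj_conj]

/-- The circle of special Kähler structures with a given metric. -/
def circleMap (S : SpecialKahlerStructure M) (c : Circle) :
    {S' : SpecialKahlerStructure M // S'.metric = S.metric} :=
  ⟨S.twist (starRingEnd ℂ c) (by rw [RCLike.norm_conj, Circle.norm_coe]), rfl⟩

lemma cubicForm_circleMap (c : Circle) (x : M) (u v w : TangentSpace 𝓘(ℝ, ℂ) x) :
    (S.circleMap c).1.cubicForm x u v w = (c : ℂ) * S.cubicForm x u v w := by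
  rw [circleMap, S.cubicForm_twist, Complex.conj_conj]

/-- The metric is constant and each value `D_X Y + conj(c) B(X, Y)` is affine in `conj(c)`. -/
lemma continuous_circleMap : Continuous S.circleMap := by
  refine continuous_induced_rng.2 (continuous_iff_coinduced_le.2 (le_inf ?_ ?_))
  · exact continuous_iff_coinduced_le.1 (continuous_induced_rng.2 (continuous_of_const fun _ _ => rfl))
  · refine continuous_iff_coinduced_le.1
      (continuous_induced_rng.2 (continuous_pi fun p => continuous_pi fun x => ?_))
    have h : Continuous fun c : Circle => (c : ℂ) := by fun_prop
    have h' : Continuous fun c : Circle =>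
        toC (S.conn.commCov p.1 p.2 x) +
          (starRingEnd ℂ (c : ℂ)) * toC (S.conn.antiField p.1 p.2 x) :=
      continuous_const.add ((Complex.continuous_conj.comp h).mul continuous_const)
    exact (show @Continuous _ (TangentSpace 𝓘(ℝ, ℂ) x) _ _ _ from h').congr fun c =>
      (S.conn.twist_eq _ p.2 x (p.1 x)).symm

/-- With the metric fixed, the values `∇_X Y` separate structures; extending tangent vectors to
fields recovers the connection from them. -/
instance t2Space_sameMetric :
    T2Space {S' : SpecialKahlerStructure M // S'.metric = S.metric} := by
  have : ∀ x : M, T2Space (TangentSpace 𝓘(ℝ, ℂ) x) := fun _ => inferInstanceAs (T2Space ℂ)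
  refine T2Space.of_injective_continuous
    (f := fun S' (p : VField M × VField M) => S'.1.conn.cov p.1 p.2) ?_ ?_
  · rintro ⟨S₁, h₁⟩ ⟨S₂, h₂⟩ h
    refine Subtype.ext (SpecialKahlerStructure.ext (h₁.trans h₂.symm) ?_)
    apply Connection.ext
    funext Y x
    ext v
    have := congrFun (congrFun h (FiberBundle.extend ℂ v, Y)) x
    simpa only [Connection.cov, FiberBundle.extend_apply_self] using this
  · have h : Continuous fun (S' : SpecialKahlerStructure M) (p : VField M × VField M) =>
        S'.conn.cov p.1 p.2 := continuous_iff_le_induced.2 inf_le_right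
    exact h.comp continuous_subtype_val

/-- A nonzero value of `Ξ` recovers the parameter; surjectivity is the constancy of the ratio of
cubic forms. -/
lemma bijective_circleMap [PreconnectedSpace M] (h : ∃ x u v w, S.cubicForm x u v w ≠ 0) :
    Function.Bijective S.circleMap := by
  constructor
  · intro c d hcd
    obtain ⟨x, u, v, w, hne⟩ := h
    have h1 := S.cubicForm_circleMap c x u v w
    rw [hcd, S.cubicForm_circleMap] at h1
    exact Circle.ext (mul_right_cancel₀ hne h1.symm)
  · rintro ⟨S', hS'⟩
    obtain ⟨c, hc, h1⟩ := exists_cubicForm_eq hS'.symm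
    obtain ⟨c, rfl⟩ : ∃ c' : Circle, (c' : ℂ) = c := ⟨⟨c, mem_sphere_zero_iff_norm.2 hc⟩, rfl⟩
    refine ⟨c, Subtype.ext ?_⟩
    refine eq_of_cubicForm_eq hS'.symm fun x u v w => ?_
    exact (S.cubicForm_circleMap _ x u v w).trans (h1 x u v w).symm

end SpecialKahlerStructure

end

theorem mainTheorem7 (M : Type*) [TopologicalSpace M] [T2Space M] [ConnectedSpace M]
    [ChartedSpace ℂ M] [IsManifold 𝓘(ℂ) ω M] :
    (∀ S S' : SpecialKahlerStructure M, S.metric = S'.metric →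
      ∃ lam : ℂ, ‖lam‖ = 1 ∧ ∀ x u v w, S'.cubicForm x u v w = lam * S.cubicForm x u v w) ∧
    (∀ (S : SpecialKahlerStructure M) (lam : ℂ), ‖lam‖ = 1 →
      ∃! S' : SpecialKahlerStructure M, S'.metric = S.metric ∧
        ∀ x u v w, S'.cubicForm x u v w = lam * S.cubicForm x u v w) ∧
    (∀ S : SpecialKahlerStructure M, (∃ x u v w, S.cubicForm x u v w ≠ 0) →
      ∃ e : Circle ≃ₜ {S' : SpecialKahlerStructure M // S'.metric = S.metric},
        ∀ lam : Circle, ∀ x u v w,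
          (e lam).1.cubicForm x u v w = (lam : ℂ) * S.cubicForm x u v w) := by
  refine ⟨fun S S' h => SpecialKahlerStructure.exists_cubicForm_eq h,
    fun S lam h => S.existsUnique_cubicForm_eq h, fun S h => ?_⟩
  -- A continuous bijection from the compact circle to a Hausdorff space is a homeomorphism.
  have hc : Continuous (Equiv.ofBijective _ (S.bijective_circleMap h)) := S.continuous_circleMap
  exact ⟨hc.homeoOfEquivCompactToT2, fun lam x u v w => S.cubicForm_circleMap lam x u v w⟩
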